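/- Let $M$ be a compact smooth manifold with a Riemannian metric $g$ and an integrable almost complex structure $J$ that is skew-symmetric with respect to $g$, and let $\omega=g(J\cdot,\cdot)$ be the fundamental 2-form. Suppose that $(M,g,J)$ is locally conformally Kähler (LCK) with Lee form $\theta$, i.e. $\theta$ is a closed 1-form on $M$ with $d\omega=-2\theta\wedge\omega$, and that $(M,g,J)$ is not Kähler, i.e. $d\omega\neq 0$. Let $G$ be a compact connected Lie group acting smoothly, effectively and transitively on $M$ and preserving both $g$ and $J$ (so that $M=G/H$ is a compact homogeneous LCK manifold). Let $\mathfrak z$ be the center of the Lie algebra $\mathfrak g$ of $G$, let $\theta^\sharp$ be the vector field defined by $g(\theta^\sharp,\cdot)=\theta$, and for $\zeta\in\mathfrak g$ let $X^\zeta_x=\frac{d}{dt}\big|_{t=0}\exp(t\zeta)\cdot x$ be the fundamental vector field of $\zeta$ on $M$. Then $$\dim\mathfrak z\leq 2 .$$ Moreover, if $\dim\mathfrak z\geq 2$, then $J\theta^\sharp$ is a central fundamental vector field: there exists $\zeta\in\mathfrak z$ with $J\theta^\sharp=X^\zeta$ on all of $M$. -/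

import Mathlib

open scoped Manifold ContDiff

noncomputable section

namespace LCK

/-- A `C^∞` real Lie group is in particular a Lie group of the class needed for its Lie algebra. -/
instance instLieGroupMinSmoothness {F : Type*} [NormedAddCommGroup F] [NormedSpace ℝ F]
    {H' : Type*} [TopologicalSpace H'] {I' : ModelWithCorners ℝ F H'}
    {G : Type*} [TopologicalSpace G] [ChartedSpace H' G] [Group G] [LieGroup I' ∞ G] :
    LieGroup I' (minSmoothness ℝ 3) G := by
  rw [minSmoothness_of_isRCLikeNormedField]
  infer_instance

section Tensors

variable {E : Type*} [NormedAddCommGroup E] [NormedSpace ℝ E]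
  {H : Type*} [TopologicalSpace H] (I : ModelWithCorners ℝ E H)
  {M : Type*} [TopologicalSpace M] [ChartedSpace H M]

/-- Smooth vector fields. -/
def IsSmoothField [IsManifold I ∞ M] (X : ∀ x : M, TangentSpace I x) : Prop :=
  ContMDiff I (I.prod 𝓘(ℝ, E)) ∞ (fun x => Bundle.TotalSpace.mk' E x (X x))

/-- Smooth fields of endomorphisms of the tangent bundle. -/
def IsSmoothEndo [IsManifold I ∞ M]
    (J : ∀ x : M, TangentSpace I x →L[ℝ] TangentSpace I x) : Prop :=
  ContMDiff I (I.prod 𝓘(ℝ, E →L[ℝ] E)) ∞ (fun x => Bundle.TotalSpace.mk' (E →L[ℝ] E) x (J x))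

/-- Smooth one-forms. -/
def IsSmoothOneForm [IsManifold I ∞ M] (α : ∀ x : M, TangentSpace I x →L[ℝ] ℝ) : Prop :=
  ContMDiff I (I.prod 𝓘(ℝ, E →L[ℝ] ℝ)) ∞ (fun x => Bundle.TotalSpace.mk' (E →L[ℝ] ℝ) x (α x))

/-- The exterior derivative of a one-form, evaluated on two vector fields:
`dα(X, Y) = X(α(Y)) - Y(α(X)) - α([X, Y])`. -/
def extDerivOne (α : ∀ x : M, TangentSpace I x →L[ℝ] ℝ)
    (X Y : ∀ x : M, TangentSpace I x) (x : M) : ℝ :=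
  mvfderiv I (fun y => α y (Y y)) x (X x) - mvfderiv I (fun y => α y (X y)) x (Y x)
    - α x (VectorField.mlieBracket I X Y x)

/-- The exterior derivative of a two-form, evaluated on three vector fields. -/
def extDerivTwo (Ω : ∀ x : M, TangentSpace I x →L[ℝ] TangentSpace I x →L[ℝ] ℝ)
    (X Y Z : ∀ x : M, TangentSpace I x) (x : M) : ℝ :=
  mvfderiv I (fun y => Ω y (Y y) (Z y)) x (X x)
    - mvfderiv I (fun y => Ω y (X y) (Z y)) x (Y x)
    + mvfderiv I (fun y => Ω y (X y) (Y y)) x (Z x)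
    - Ω x (VectorField.mlieBracket I X Y x) (Z x)
    + Ω x (VectorField.mlieBracket I X Z x) (Y x)
    - Ω x (VectorField.mlieBracket I Y Z x) (X x)

/-- The wedge product `θ ∧ Ω` of a one-form and a two-form, evaluated on three vector fields. -/
def wedgeOneTwo (θ : ∀ x : M, TangentSpace I x →L[ℝ] ℝ)
    (Ω : ∀ x : M, TangentSpace I x →L[ℝ] TangentSpace I x →L[ℝ] ℝ)
    (X Y Z : ∀ x : M, TangentSpace I x) (x : M) : ℝ :=
  θ x (X x) * Ω x (Y x) (Z x) - θ x (Y x) * Ω x (X x) (Z x) + θ x (Z x) * Ω x (X x) (Y x)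

/-- The vector field `J X`. -/
def applyField (J : ∀ x : M, TangentSpace I x →L[ℝ] TangentSpace I x)
    (X : ∀ x : M, TangentSpace I x) : ∀ x : M, TangentSpace I x :=
  fun x => J x (X x)

/-- The Nijenhuis tensor `[X, Y] + J[X, JY] + J[JX, Y] - [JX, JY]`. -/
def nijenhuis (J : ∀ x : M, TangentSpace I x →L[ℝ] TangentSpace I x)
    (X Y : ∀ x : M, TangentSpace I x) (x : M) : TangentSpace I x :=
  VectorField.mlieBracket I X Y x
    + J x (VectorField.mlieBracket I X (applyField I J Y) x)
    + J x (VectorField.mlieBracket I (applyField I J X) Y x)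
    - VectorField.mlieBracket I (applyField I J X) (applyField I J Y) x

end Tensors

section Structures

variable {E : Type*} [NormedAddCommGroup E] [NormedSpace ℝ E]
  {H : Type*} [TopologicalSpace H] {I : ModelWithCorners ℝ E H}
  {M : Type*} [TopologicalSpace M] [ChartedSpace H M] [IsManifold I ∞ M]

/-- Smooth Riemannian metrics on `M`. -/
abbrev Metric (I : ModelWithCorners ℝ E H) (M : Type*) [TopologicalSpace M] [ChartedSpace H M]
    [IsManifold I ∞ M] :=
  Bundle.ContMDiffRiemannianMetric I ∞ E (fun x : M => TangentSpace I x)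

/-- The fundamental two-form `ω = g(J ·, ·)`. -/
def fundamentalForm (g : Metric I M) (J : ∀ x : M, TangentSpace I x →L[ℝ] TangentSpace I x)
    (x : M) : TangentSpace I x →L[ℝ] TangentSpace I x →L[ℝ] ℝ :=
  (g.inner x).comp (J x)

/-- `(M, g, J)` is Hermitian: `J` is a smooth, `g`-skew-symmetric endomorphism field of the tangent
bundle with `J² = -id` and vanishing Nijenhuis tensor. -/
structure IsHermitian (g : Metric I M)
    (J : ∀ x : M, TangentSpace I x →L[ℝ] TangentSpace I x) : Prop where
  smooth : IsSmoothEndo I J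
  sq_eq_neg : ∀ (x : M) (u : TangentSpace I x), J x (J x u) = -u
  skew : ∀ (x : M) (u v : TangentSpace I x), g.inner x (J x u) v = -g.inner x u (J x v)
  integrable : ∀ X Y : (∀ x : M, TangentSpace I x), IsSmoothField I X → IsSmoothField I Y →
    ∀ x, nijenhuis I J X Y x = 0

/-- `(M, g, J)` is Kähler: it is Hermitian and its fundamental two-form is closed. -/
structure IsKahler (g : Metric I M)
    (J : ∀ x : M, TangentSpace I x →L[ℝ] TangentSpace I x) : Prop where
  hermitian : IsHermitian g J
  closed : ∀ X Y Z : (∀ x : M, TangentSpace I x),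
    IsSmoothField I X → IsSmoothField I Y → IsSmoothField I Z →
    ∀ x, extDerivTwo I (fundamentalForm g J) X Y Z x = 0

/-- `(M, g, J)` is locally conformally Kähler with Lee form `θ`: it is Hermitian, `θ` is a smooth
closed one-form, and `dω = -2 θ ∧ ω`. -/
structure IsLCK (g : Metric I M) (J : ∀ x : M, TangentSpace I x →L[ℝ] TangentSpace I x)
    (θ : ∀ x : M, TangentSpace I x →L[ℝ] ℝ) : Prop where
  hermitian : IsHermitian g J
  smooth : IsSmoothOneForm I θ
  closed : ∀ X Y : (∀ x : M, TangentSpace I x), IsSmoothField I X → IsSmoothField I Y →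
    ∀ x, extDerivOne I θ X Y x = 0
  lee : ∀ X Y Z : (∀ x : M, TangentSpace I x),
    IsSmoothField I X → IsSmoothField I Y → IsSmoothField I Z →
    ∀ x, extDerivTwo I (fundamentalForm g J) X Y Z x
      = -2 * wedgeOneTwo I θ (fundamentalForm g J) X Y Z x

theorem exists_sharp [FiniteDimensional ℝ E] (g : Metric I M)
    (α : ∀ x : M, TangentSpace I x →L[ℝ] ℝ) (x : M) :
    ∃ u : TangentSpace I x, ∀ v : TangentSpace I x, g.inner x u v = α x v := by
  have : FiniteDimensional ℝ (TangentSpace I x) := inferInstanceAs (FiniteDimensional ℝ E)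
  let φ : TangentSpace I x →ₗ[ℝ] Module.Dual ℝ (TangentSpace I x) :=
    { toFun := fun u => (g.inner x u : TangentSpace I x →ₗ[ℝ] ℝ)
      map_add' := fun u v => by ext w; simp
      map_smul' := fun c u => by ext w; simp }
  have hinj : Function.Injective φ := by
    rw [injective_iff_map_eq_zero]
    intro u hu
    by_contra h
    have h1 := g.pos x u h
    have h2 : g.inner x u u = 0 := LinearMap.congr_fun hu u
    exact absurd h2 h1.ne'
  have hsurj : Function.Surjective φ :=
    (LinearMap.injective_iff_surjective_of_finrank_eq_finrank
      (Subspace.dual_finrank_eq (K := ℝ) (V := TangentSpace I x)).symm).1 hinj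
  obtain ⟨u, hu⟩ := hsurj (α x : TangentSpace I x →ₗ[ℝ] ℝ)
  exact ⟨u, fun v => LinearMap.congr_fun hu v⟩

/-- The vector field `α♯` which is metrically dual to the one-form `α`. -/
def sharp [FiniteDimensional ℝ E] (g : Metric I M) (α : ∀ x : M, TangentSpace I x →L[ℝ] ℝ)
    (x : M) : TangentSpace I x :=
  Classical.choose (exists_sharp g α x)

theorem inner_sharp [FiniteDimensional ℝ E] (g : Metric I M)
    (α : ∀ x : M, TangentSpace I x →L[ℝ] ℝ) (x : M) (v : TangentSpace I x) :
    g.inner x (sharp g α x) v = α x v :=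
  Classical.choose_spec (exists_sharp g α x) v

end Structures

section Actions

variable {E : Type*} [NormedAddCommGroup E] [NormedSpace ℝ E]
  {H : Type*} [TopologicalSpace H] {I : ModelWithCorners ℝ E H}
  {M : Type*} [TopologicalSpace M] [ChartedSpace H M] [IsManifold I ∞ M]
  {F : Type*} [NormedAddCommGroup F] [NormedSpace ℝ F]
  {H' : Type*} [TopologicalSpace H'] (I' : ModelWithCorners ℝ F H')
  (G : Type*) [TopologicalSpace G] [ChartedSpace H' G] [Group G] [MulAction G M]

/-- Every element of `G` acts by isometries of `g`. -/
def PreservesMetric (g : Metric I M) : Prop :=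
  ∀ (a : G) (x : M) (u v : TangentSpace I x),
    g.inner (a • x) (mfderiv I I (fun y : M => a • y) x u) (mfderiv I I (fun y : M => a • y) x v)
      = g.inner x u v

/-- Every element of `G` acts by holomorphic maps: its differential commutes with `J`. -/
def PreservesComplex (J : ∀ x : M, TangentSpace I x →L[ℝ] TangentSpace I x) : Prop :=
  ∀ (a : G) (x : M) (u : TangentSpace I x),
    mfderiv I I (fun y : M => a • y) x (J x u) = J (a • x) (mfderiv I I (fun y : M => a • y) x u)

variable {G} in
/-- The fundamental vector field of `ξ ∈ 𝔤`: the differential at the identity of the orbit map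
`a ↦ a • x`, applied to `ξ`; by the chain rule this is `d/dt|₀ exp(tξ) • x`. -/
def fundamentalField (I : ModelWithCorners ℝ E H) {M : Type*} [TopologicalSpace M]
    [ChartedSpace H M] [MulAction G M] (ξ : GroupLieAlgebra I' G) (x : M) : TangentSpace I x :=
  (one_smul G x) ▸ (mfderiv I' I (fun a : G => a • x) 1 ξ)

end Actions

end LCK

end

/-!
The centre of the Lie algebra is controlled by two numbers: the values of `θ` and of `ω(·, X^T)` on
a central fundamental field at one point, for a fixed element `T` of the Lie algebra with
`θ(X^T) ≠ 0`.

The Lee form `θ` is invariant under `G` (`IsLCK.preservesOneForm`). Indeed `dω` is invariant, so the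
difference `β` of `θ` and one of its translates satisfies `β ∧ ω = 0`, and wedging with `ω` is
injective on one-forms in real dimension at least three
(`eq_zero_of_wedge_fundamentalForm_eq_zero`); in smaller dimension the manifold would be Kähler. As
`θ` is closed and invariant, `θ(X^ξ)` is a constant for every `ξ` in the Lie algebra
(`oneForm_fundamentalField_eq`). These constants do not all vanish
(`exists_fundamentalField_ne_zero`), because the fundamental fields of a transitive action of a Lie
group with countable base suffice to detect that a local primitive of `θ` is not constant. This
gives `T`.

If `Z` is central, then `X^Z` is an invariant field (`preservesField_fundamentalField`) and commutes
with all fundamental fields. Hence `dω(X^Z, X^T, V) = V(f)` for the function `f = ω(X^Z, X^T)`. If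
moreover `θ(X^Z) = 0`, then `dω = -2 θ ∧ ω` becomes `V(f) = 2 θ(X^T) ω(X^Z, V) - 2 θ(V) f`. At a
maximum of `f`, which exists as `M` is compact, the left side vanishes for all `V`, so that
`ω(X^Z, ·)` is a multiple of `θ` there, and by invariance it is the same multiple of `θ` everywhere
(`IsLCK.fundamentalForm_center`). If this multiple is zero, then `X^Z = 0`, and `Z = 0` because the
action is effective (`eq_zero_of_fundamentalField_eq_zero`). So `Z ↦ (θ(X^Z), ω(X^Z, X^T))` at a
point is an injective map from the centre to `ℝ²`. If the centre has dimension two, this map is also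
surjective, and a suitable `Z` with `θ(X^Z) = 0` satisfies `ω(X^Z, ·) = -θ`, that is `X^Z = J θ♯`.

Invariance is turned into differential identities without flows or one-parameter subgroups: for any
smooth family of maps which starts at the identity, the derivative of the pullbacks of a vector
field is a Lie bracket (`hasFDerivAt_mpullback_family`). This is applied to the action of `G` on
`M`, parametrized by a chart of `G` at `1` (`groupParam`), and to the right translations of `G`,
where it shows that the derivative of the adjoint action is the bracket of the Lie algebra.

Every tangent space of `M` is by definition the model space `E`. Equalities of tangent vectors at
points such as `1 • x` and `x`, which are only provably equal, are stated as equalities in `E`.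
-/

open scoped Manifold ContDiff Topology

noncomputable section

namespace LCK

set_option linter.unusedSectionVars false

/-! ### Derivatives of pullbacks along a family of maps of a vector space -/

section VectorSpace

variable {P : Type*} [NormedAddCommGroup P] [NormedSpace ℝ P]
  {E : Type*} [NormedAddCommGroup E] [NormedSpace ℝ E] [CompleteSpace E]

/-- The Lie derivative as the derivative of a pullback, without flows: if the maps `β (p, ·)` depend
on a parameter `p` and are the identity for `p = 0`, the derivative at `p = 0` of the pullbacks of
`V` is the bracket of `V` with the field of first-order variations of `β`. Since only the first
derivative in `p` matters, the parameter may range over any normed space. -/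
theorem hasFDerivAt_pullback_family {β : P × E → E} {y₀ : E} (hβ : ContDiffAt ℝ 2 β (0, y₀))
    (h0 : ∀ᶠ y in 𝓝 y₀, β (0, y) = y) {V : E → E} (hV : DifferentiableAt ℝ V y₀) :
    ∃ A : P →L[ℝ] E,
      HasFDerivAt (fun p => (fderiv ℝ (fun y => β (p, y)) y₀).inverse (V (β (p, y₀)))) A 0 ∧
      ∀ ξ, A ξ = VectorField.lieBracket ℝ (fun y => fderiv ℝ (fun p => β (p, y)) 0 ξ) V y₀ := by
  have hy0 : β (0, y₀) = y₀ := h0.self_of_nhds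
  have hd : ∀ᶠ q in 𝓝 ((0 : P), y₀), DifferentiableAt ℝ β q := by
    filter_upwards [hβ.eventually (by simp)] with q hq
    exact hq.differentiableAt (by simp)
  have h2 : DifferentiableAt ℝ (fderiv ℝ β) (0, y₀) :=
    (hβ.fderiv_right (m := 1) (by norm_num)).differentiableAt (by simp)
  have hfst : ∀ᶠ y in 𝓝 y₀, fderiv ℝ (fun p => β (p, y)) 0
      = (fderiv ℝ β (0, y)).comp (ContinuousLinearMap.inl ℝ P E) := by
    have : ContinuousAt (fun y : E => ((0 : P), y)) y₀ := by fun_prop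
    filter_upwards [this.eventually hd] with y hy
    exact (hy.hasFDerivAt.comp (0 : P) (hasFDerivAt_prodMk_left 0 y)).fderiv
  have hsnd : ∀ᶠ p in 𝓝 (0 : P), fderiv ℝ (fun y => β (p, y)) y₀
      = (fderiv ℝ β (p, y₀)).comp (ContinuousLinearMap.inr ℝ P E) := by
    have : ContinuousAt (fun p : P => (p, y₀)) 0 := by fun_prop
    filter_upwards [this.eventually hd] with p hp
    exact (hp.hasFDerivAt.comp y₀ (hasFDerivAt_prodMk_right p y₀)).fderiv
  set B := fderiv ℝ (fderiv ℝ β) (0, y₀) with hB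
  have hsymm : ∀ u v, B u v = B v u := fun u v =>
    (hβ.isSymmSndFDerivAt (by simp)) u v
  -- the partial derivative in the second variable, its value at `0` and its derivative
  have hid : fderiv ℝ (fun y => β (0, y)) y₀ = ContinuousLinearMap.id ℝ E := by
    have : (fun y => β (0, y)) =ᶠ[𝓝 y₀] id := h0
    rw [this.fderiv_eq, fderiv_id]
  let D : P →L[ℝ] (E →L[ℝ] E) :=
    ((ContinuousLinearMap.compL ℝ E (P × E) E).flip (ContinuousLinearMap.inr ℝ P E)).comp
      (B.comp (ContinuousLinearMap.inl ℝ P E))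
  have hD : HasFDerivAt (fun p => fderiv ℝ (fun y => β (p, y)) y₀) D 0 := by
    have h1 : HasFDerivAt (fun p : P => fderiv ℝ β (p, y₀))
        (B.comp (ContinuousLinearMap.inl ℝ P E)) 0 :=
      HasFDerivAt.comp (0 : P) (f := fun p : P => (p, y₀)) h2.hasFDerivAt
        (hasFDerivAt_prodMk_left 0 y₀)
    have h3 := (((ContinuousLinearMap.compL ℝ E (P × E) E).flip
      (ContinuousLinearMap.inr ℝ P E)).hasFDerivAt).comp (0 : P) h1
    exact h3.congr_of_eventuallyEq hsnd
  have hInv : HasFDerivAt (fun p => (fderiv ℝ (fun y => β (p, y)) y₀).inverse) (-D) 0 := by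
    have h1 := hasFDerivAt_ringInverse (𝕜 := ℝ) (1 : (E →L[ℝ] E)ˣ)
    have h4 : HasFDerivAt (Ring.inverse : (E →L[ℝ] E) → (E →L[ℝ] E))
        (-ContinuousLinearMap.mulLeftRight ℝ (E →L[ℝ] E) ↑(1 : (E →L[ℝ] E)ˣ)⁻¹
          ↑(1 : (E →L[ℝ] E)ˣ)⁻¹)
        (fderiv ℝ (fun y => β (0, y)) y₀) := by
      rw [hid]; exact h1
    have h3 := h4.comp (0 : P) hD
    have e : (-ContinuousLinearMap.mulLeftRight ℝ (E →L[ℝ] E) ↑(1 : (E →L[ℝ] E)ˣ)⁻¹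
        ↑(1 : (E →L[ℝ] E)ˣ)⁻¹).comp D = -D := by
      ext p v; simp [ContinuousLinearMap.mulLeftRight_apply]
    rw [e] at h3
    simpa [Function.comp_def, ContinuousLinearMap.ringInverse_eq_inverse] using! h3
  have hV' : HasFDerivAt (fun p => V (β (p, y₀)))
      ((fderiv ℝ V y₀).comp ((fderiv ℝ β (0, y₀)).comp (ContinuousLinearMap.inl ℝ P E))) 0 := by
    have h1 : HasFDerivAt (fun p : P => β (p, y₀))
        ((fderiv ℝ β (0, y₀)).comp (ContinuousLinearMap.inl ℝ P E)) 0 :=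
      HasFDerivAt.comp (0 : P) (f := fun p : P => (p, y₀)) hd.self_of_nhds.hasFDerivAt
        (hasFDerivAt_prodMk_left 0 y₀)
    refine HasFDerivAt.comp (0 : P) (f := fun p : P => β (p, y₀)) (g := V) ?_ h1
    rw [hy0]; exact hV.hasFDerivAt
  refine ⟨_, hInv.clm_apply hV', fun ξ => ?_⟩
  have hX : HasFDerivAt (fun y => fderiv ℝ (fun p => β (p, y)) 0 ξ)
      ((ContinuousLinearMap.apply ℝ E ((ξ, 0) : P × E)).comp
        (B.comp (ContinuousLinearMap.inr ℝ P E))) y₀ := by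
    have h1 : HasFDerivAt (fun y : E => fderiv ℝ β (0, y))
        (B.comp (ContinuousLinearMap.inr ℝ P E)) y₀ :=
      HasFDerivAt.comp y₀ (f := fun y : E => ((0 : P), y)) h2.hasFDerivAt
        (hasFDerivAt_prodMk_right 0 y₀)
    have h3 := (ContinuousLinearMap.apply ℝ E ((ξ, 0) : P × E)).hasFDerivAt.comp y₀ h1
    refine h3.congr_of_eventuallyEq ?_
    filter_upwards [hfst] with y hy
    rw [hy]; simp
  have hX0 := hfst.self_of_nhds
  rw [VectorField.lieBracket, hX.fderiv, hX0, hid]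
  -- the two mixed second derivatives of `β` are matched by symmetry
  simp [hy0, D, hsymm ((0 : P), V y₀) (ξ, 0)]
  abel

end VectorSpace

/-! ### Derivatives of pullbacks along a family of maps of a manifold -/

section ManifoldFamily

variable {P : Type*} [NormedAddCommGroup P] [NormedSpace ℝ P]
  {E : Type*} [NormedAddCommGroup E] [NormedSpace ℝ E] [CompleteSpace E]
  {H : Type*} [TopologicalSpace H] {I : ModelWithCorners ℝ E H} [I.Boundaryless]
  {M : Type*} [TopologicalSpace M] [ChartedSpace H M] [IsManifold I ∞ M]

/-- The manifold version of `hasFDerivAt_pullback_family`, obtained by reading the maps `α p` in the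
chart at `x`. The field `X ξ` is the first-order variation of `α` in the parameter direction `ξ`;
the tangent spaces at `α 0 y` and at `y` are both read as `E`. -/
theorem hasFDerivAt_mpullback_family {α : P → M → M} {x : M}
    (hα : ContMDiffAt (𝓘(ℝ, P).prod I) I 2 (fun q : P × M => α q.1 q.2) (0, x))
    (h0 : ∀ y, α 0 y = y) {V : ∀ y : M, TangentSpace I y}
    (hV : MDifferentiableAt I I.tangent (fun y => (⟨y, V y⟩ : TangentBundle I M)) x)
    {X : P → ∀ y : M, TangentSpace I y}
    (hX : ∀ ξ y, @Eq E (X ξ y) (mfderiv 𝓘(ℝ, P) I (fun p => α p y) 0 ξ)) :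
    ∃ A : P →L[ℝ] E,
      HasFDerivAt (fun p => (VectorField.mpullback I I (α p) V x : E)) A 0 ∧
      ∀ ξ, A ξ = VectorField.mlieBracket I (X ξ) V x := by
  have : IsManifold I 1 M := IsManifold.of_le (n := ∞) (by simp)
  have : IsManifold I 2 M := IsManifold.of_le (n := ∞) ENat.LEInfty.out
  set φ := extChartAt I x with hφ
  set y₀ := φ x with hy₀
  -- the family `α` read in the chart
  let β : P × E → E := fun q => φ (α q.1 (φ.symm q.2))
  have hsymm0 : φ.symm y₀ = x := extChartAt_to_inv x
  have htarget : φ.target ∈ 𝓝 y₀ := extChartAt_target_mem_nhds x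
  have hpair : ContMDiffAt 𝓘(ℝ, P × E) (𝓘(ℝ, P).prod I) ∞
      (fun q : P × E => (q.1, φ.symm q.2)) (0, y₀) := by
    refine ContMDiffAt.prodMk contDiffAt_fst.contMDiffAt ?_
    refine ContMDiffAt.comp (I' := 𝓘(ℝ, E)) ((0 : P), y₀) (f := Prod.snd) (g := φ.symm) ?_
      contDiffAt_snd.contMDiffAt
    exact (contMDiffOn_extChartAt_symm x).contMDiffAt htarget
  have hβ : ContDiffAt ℝ 2 β (0, y₀) := by
    rw [← contMDiffAt_iff_contDiffAt]
    have h1 : ContMDiffAt 𝓘(ℝ, P × E) I 2 (fun q : P × E => α q.1 (φ.symm q.2)) (0, y₀) := by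
      refine ContMDiffAt.comp_of_eq (I' := 𝓘(ℝ, P).prod I) (f := fun q : P × E => (q.1, φ.symm q.2))
        (g := fun q : P × M => α q.1 q.2) (y := (0, x)) hα
        (hpair.of_le ENat.LEInfty.out) ?_
      simp [hsymm0]
    refine ContMDiffAt.comp_of_eq (I' := I) (g := φ) (y := x) ?_ h1 ?_
    · exact (contMDiffAt_extChartAt (n := 2))
    · simp [hsymm0, h0]
  have hβ0 : ∀ᶠ y in 𝓝 y₀, β (0, y) = y := by
    filter_upwards [htarget] with y hy
    simp only [β, h0]
    exact φ.right_inv hy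
  -- the field `V` read in the chart
  let V' : E → E := VectorField.mpullbackWithin 𝓘(ℝ, E) I φ.symm V (Set.range I)
  have hV' : DifferentiableAt ℝ V' y₀ := by
    have := MDifferentiableWithinAt.differentiableWithinAt_mpullbackWithin_vectorField
      (V := V) (s := Set.univ) hV.mdifferentiableWithinAt
    have h1 : DifferentiableWithinAt ℝ V' (Set.range I) y₀ := by
      rw [Set.preimage_univ, Set.univ_inter] at this
      exact this
    rwa [I.range_eq_univ, differentiableWithinAt_univ] at h1
  obtain ⟨A, hA, hA'⟩ := hasFDerivAt_pullback_family hβ hβ0 hV'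
  have hev : ∀ᶠ p in 𝓝 (0 : P), ContMDiffAt (𝓘(ℝ, P).prod I) I 2
      (fun q : P × M => α q.1 q.2) (p, x) := by
    have hc : ContinuousAt (fun p : P => (p, x)) 0 := by fun_prop
    exact hc.eventually ((contMDiffAt_iff_contMDiffAt_nhds (by simp)).1 hα)
  refine ⟨A, hA.congr_of_eventuallyEq ?_, fun ξ => ?_⟩
  · have hcont : ContinuousAt (fun p : P => α p x) 0 :=
      ContinuousAt.comp (f := fun p : P => (p, x)) (g := fun q : P × M => α q.1 q.2)
        hα.continuousAt (by fun_prop)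
    have hsrc : ∀ᶠ p in 𝓝 (0 : P), α p x ∈ φ.source := by
      refine hcont.eventually (p := fun z => z ∈ φ.source) ?_
      simp only [h0]
      exact extChartAt_source_mem_nhds x
    have hVeq : ∀ᶠ p in 𝓝 (0 : P), V (α p x) = VectorField.mpullback I 𝓘(ℝ, E) φ V' (α p x) := by
      refine hcont.eventually
        (p := fun z => V z = VectorField.mpullback I 𝓘(ℝ, E) φ V' z) ?_
      simp only [h0]
      have := VectorField.eventuallyEq_mpullback_mpullbackWithin_extChartAt (I := I)
        (s := Set.univ) (x := x) V
      rw [nhdsWithin_univ] at this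
      exact this
    filter_upwards [hev, hsrc, hVeq] with p hp hps hpV
    have hαp : MDifferentiableAt I I (α p) x := by
      have : ContMDiffAt I I 2 (fun y => α p y) x :=
        ContMDiffAt.comp (I' := 𝓘(ℝ, P).prod I) x (f := fun y : M => (p, y))
          (g := fun q : P × M => α q.1 q.2) hp (contMDiffAt_const.prodMk contMDiffAt_id)
      exact this.mdifferentiableAt (by simp)
    have hφp : MDifferentiableAt I 𝓘(ℝ, E) φ (α p x) :=
      mdifferentiableAt_extChartAt (by simpa [hφ] using hps)
    have hsymmd : MDifferentiableAt 𝓘(ℝ, E) I φ.symm y₀ :=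
      ((contMDiffOn_extChartAt_symm (n := ∞) x).contMDiffAt htarget).mdifferentiableAt (by simp)
    have hsymm1 : mfderiv 𝓘(ℝ, E) I φ.symm y₀ = ContinuousLinearMap.id ℝ E := by
      have := mfderivWithin_range_extChartAt_symm (I := I) (x := x)
      rw [I.range_eq_univ, mfderivWithin_univ] at this
      exact this
    obtain ⟨Φ, hΦ⟩ : ∃ Φ : E →L[ℝ] E, Φ = mfderiv I 𝓘(ℝ, E) φ (α p x) := ⟨_, rfl⟩
    obtain ⟨L, hL⟩ : ∃ L : E →L[ℝ] E, L = mfderiv I I (α p) x := ⟨_, rfl⟩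
    have hd : fderiv ℝ (fun y => β (p, y)) y₀ = Φ.comp L := by
      have h1 : HasMFDerivAt 𝓘(ℝ, E) I φ.symm y₀ (ContinuousLinearMap.id ℝ E) := by
        rw [← hsymm1]; exact hsymmd.hasMFDerivAt
      have h2 : HasMFDerivAt I I (α p) (φ.symm y₀) L := by
        rw [hsymm0, hL]; exact hαp.hasMFDerivAt
      have h3 : HasMFDerivAt I 𝓘(ℝ, E) φ (α p (φ.symm y₀)) Φ := by
        rw [hsymm0, hΦ]; exact hφp.hasMFDerivAt
      have h4 : HasMFDerivAt 𝓘(ℝ, E) 𝓘(ℝ, E) (fun y => β (p, y)) y₀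
          ((Φ.comp L).comp (ContinuousLinearMap.id ℝ E)) :=
        HasMFDerivAt.comp y₀ (g := fun y => φ (α p y)) (f := φ.symm)
          (HasMFDerivAt.comp (φ.symm y₀) (g := φ) (f := α p) h3 h2) h1
      have h5 : HasFDerivAt (fun y => β (p, y)) ((Φ.comp L).comp (ContinuousLinearMap.id ℝ E)) y₀ :=
        hasMFDerivAt_iff_hasFDerivAt.1 h4
      exact h5.fderiv
    have hinv : Φ.IsInvertible := by rw [hΦ]; exact isInvertible_mfderiv_extChartAt hps
    obtain ⟨v, hv⟩ : ∃ v : E, v = V (α p x) := ⟨_, rfl⟩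
    have hv' : v = Φ.inverse (V' (β (p, y₀))) := by
      rw [hv, hpV, hΦ]
      simp only [β, hsymm0]
      rfl
    have hgoal : L.inverse v = (fderiv ℝ (fun y => β (p, y)) y₀).inverse (V' (β (p, y₀))) := by
      rw [hd, hinv.inverse_comp_apply_of_left, hv']
    rw [hv, hL] at hgoal
    exact hgoal
  · have hid : (mfderiv I 𝓘(ℝ, E) φ x : E →L[ℝ] E) = ContinuousLinearMap.id ℝ E :=
      mfderiv_extChartAt_self
    have hbr : ∀ Φ : E →L[ℝ] E, Φ = ContinuousLinearMap.id ℝ E → ∀ u v : E, u = v →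
        u = Φ.inverse v := by
      rintro Φ rfl u v rfl
      simp
    rw [hA', ← VectorField.mlieBracketWithin_univ, VectorField.mlieBracketWithin_apply]
    refine hbr _ hid _ _ ?_
    simp only [Set.preimage_univ, Set.univ_inter]
    rw [← hφ, ← hy₀]
    have hrw : ∀ W : E → E, VectorField.lieBracketWithin ℝ W V' (Set.range I) y₀
        = VectorField.lieBracket ℝ W V' y₀ := by
      intro W
      rw [I.range_eq_univ, VectorField.lieBracketWithin_univ]
    refine Eq.trans ?_ (hrw _).symm
    refine Filter.EventuallyEq.lieBracket_vectorField_eq ?_ (Filter.EventuallyEq.refl _ _)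
    have hev' : ∀ᶠ y in 𝓝 y₀, ContMDiffAt (𝓘(ℝ, P).prod I) I 2
        (fun q : P × M => α q.1 q.2) (0, φ.symm y) := by
      have hc : ContinuousAt (fun y : E => ((0 : P), φ.symm y)) y₀ :=
        continuousAt_const.prodMk (continuousAt_extChartAt_symm x)
      refine hc.eventually
        (p := fun z => ContMDiffAt (𝓘(ℝ, P).prod I) I 2 (fun q : P × M => α q.1 q.2) z) ?_
      simp only [hsymm0]
      exact (contMDiffAt_iff_contMDiffAt_nhds (by simp)).1 hα
    filter_upwards [htarget, hev'] with y hy hαy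
    have hz : φ.symm y ∈ φ.source := φ.map_target hy
    have hφz : MDifferentiableAt I 𝓘(ℝ, E) φ (φ.symm y) :=
      mdifferentiableAt_extChartAt (by simpa [hφ] using hz)
    have hp : MDifferentiableAt 𝓘(ℝ, P) I (fun p => α p (φ.symm y)) 0 := by
      have : ContMDiffAt 𝓘(ℝ, P) I 2 (fun p => α p (φ.symm y)) 0 :=
        ContMDiffAt.comp (I' := 𝓘(ℝ, P).prod I) 0 (f := fun p : P => (p, φ.symm y))
          (g := fun q : P × M => α q.1 q.2) hαy (contMDiffAt_id.prodMk contMDiffAt_const)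
      exact this.mdifferentiableAt (by simp)
    obtain ⟨Φ, hΦ⟩ : ∃ Φ : E →L[ℝ] E, Φ = mfderiv I 𝓘(ℝ, E) φ (φ.symm y) := ⟨_, rfl⟩
    obtain ⟨L, hL⟩ : ∃ L : P →L[ℝ] E, L = mfderiv 𝓘(ℝ, P) I (fun p => α p (φ.symm y)) 0 :=
      ⟨_, rfl⟩
    have h3 : HasMFDerivAt I 𝓘(ℝ, E) φ (α 0 (φ.symm y)) Φ := by
      rw [h0, hΦ]; exact hφz.hasMFDerivAt
    have h4 : HasMFDerivAt 𝓘(ℝ, P) 𝓘(ℝ, E) (fun p => β (p, y)) 0 (Φ.comp L) := by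
      have hp' : HasMFDerivAt 𝓘(ℝ, P) I (fun p => α p (φ.symm y)) 0 L := by
        rw [hL]; exact hp.hasMFDerivAt
      exact HasMFDerivAt.comp (0 : P) (f := fun p => α p (φ.symm y)) (g := φ) h3 hp'
    have h5' : HasFDerivAt (fun p => β (p, y)) (Φ.comp L) 0 := hasMFDerivAt_iff_hasFDerivAt.1 h4
    have h5 : fderiv ℝ (fun p => β (p, y)) 0 = Φ.comp L := h5'.fderiv
    obtain ⟨Ψ, hΨ⟩ : ∃ Ψ : E →L[ℝ] E, Ψ = mfderivWithin 𝓘(ℝ, E) I φ.symm (Set.range I) y :=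
      ⟨_, rfl⟩
    have h6 : Ψ.inverse = Φ := by
      rw [hΨ, hΦ]
      exact ContinuousLinearMap.inverse_eq
        (mfderivWithin_extChartAt_symm_comp_mfderiv_extChartAt hy)
        (mfderiv_extChartAt_comp_mfderivWithin_extChartAt_symm hy)
    have h7 : fderiv ℝ (fun p => β (p, y)) 0 ξ = Ψ.inverse (X ξ (φ.symm y)) := by
      rw [h6, h5, hX, ← hL]
      rfl
    rw [hΨ] at h7
    exact h7

end ManifoldFamily

/-! ### The infinitesimal action of a Lie group -/

section GroupParam

variable {F : Type*} [NormedAddCommGroup F] [NormedSpace ℝ F]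
  {H' : Type*} [TopologicalSpace H'] (I' : ModelWithCorners ℝ F H') [I'.Boundaryless]
  (G : Type*) [TopologicalSpace G] [ChartedSpace H' G] [Group G] [LieGroup I' ∞ G]

/-- The local parametrization of `G` near `1` given by the inverse of the preferred chart at `1`,
translated so that `0` is sent to `1`. -/
def groupParam (p : F) : G := (extChartAt I' (1 : G)).symm (extChartAt I' (1 : G) 1 + p)

theorem groupParam_zero : groupParam I' G 0 = 1 := by
  simp [groupParam]

theorem contMDiffAt_groupParam : ContMDiffAt 𝓘(ℝ, F) I' ∞ (groupParam I' G) 0 := by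
  have : IsManifold I' ∞ G := inferInstance
  refine ContMDiffAt.comp_of_eq (I' := 𝓘(ℝ, F)) (g := (extChartAt I' (1 : G)).symm)
    (f := fun p : F => extChartAt I' (1 : G) 1 + p) (y := extChartAt I' (1 : G) 1)
    ((contMDiffOn_extChartAt_symm 1).contMDiffAt (extChartAt_target_mem_nhds 1)) ?_ (by simp)
  exact (contDiffAt_const.add contDiffAt_id).contMDiffAt

/-- The differential at `0` is the identity because the tangent space `T₁G` is, by definition, read
in the preferred chart at `1`. -/
theorem hasMFDerivAt_groupParam :
    HasMFDerivAt 𝓘(ℝ, F) I' (groupParam I' G) 0 (ContinuousLinearMap.id ℝ F) := by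
  have : IsManifold I' 1 G := IsManifold.of_le (n := ∞) (by simp)
  have h1 : HasMFDerivAt 𝓘(ℝ, F) 𝓘(ℝ, F) (fun p : F => extChartAt I' (1 : G) 1 + p) 0
      (ContinuousLinearMap.id ℝ F) :=
    ((hasFDerivAt_id (0 : F)).const_add (extChartAt I' (1 : G) 1)).hasMFDerivAt
  have hd : MDifferentiableAt 𝓘(ℝ, F) I' (extChartAt I' (1 : G)).symm (extChartAt I' (1 : G) 1) :=
    ((contMDiffOn_extChartAt_symm (n := 1) 1).contMDiffAt
      (extChartAt_target_mem_nhds 1)).mdifferentiableAt (by simp)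
  have h2 : HasMFDerivAt 𝓘(ℝ, F) I' (extChartAt I' (1 : G)).symm (extChartAt I' (1 : G) 1 + 0)
      (ContinuousLinearMap.id ℝ F) := by
    have h3 := mfderivWithin_range_extChartAt_symm (I := I') (x := (1 : G))
    rw [I'.range_eq_univ, mfderivWithin_univ] at h3
    rw [add_zero]
    have h4 := hd.hasMFDerivAt
    rw [h3] at h4
    exact h4
  have h5 : HasMFDerivAt 𝓘(ℝ, F) I' (groupParam I' G) 0
      ((ContinuousLinearMap.id ℝ F).comp (ContinuousLinearMap.id ℝ F)) :=
    HasMFDerivAt.comp (0 : F) (g := (extChartAt I' (1 : G)).symm)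
      (f := fun p : F => extChartAt I' (1 : G) 1 + p) h2 h1
  exact h5

end GroupParam

section Action

variable {E : Type*} [NormedAddCommGroup E] [NormedSpace ℝ E] [CompleteSpace E]
  {H : Type*} [TopologicalSpace H] {I : ModelWithCorners ℝ E H} [I.Boundaryless]
  {M : Type*} [TopologicalSpace M] [ChartedSpace H M] [IsManifold I ∞ M]
  {F : Type*} [NormedAddCommGroup F] [NormedSpace ℝ F]
  {H' : Type*} [TopologicalSpace H'] (I' : ModelWithCorners ℝ F H') [I'.Boundaryless]
  {G : Type*} [TopologicalSpace G] [ChartedSpace H' G] [Group G] [LieGroup I' ∞ G]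
  [MulAction G M] [ContMDiffSMul I' I ∞ G M]

omit [CompleteSpace E] [I.Boundaryless] [IsManifold I ∞ M] [I'.Boundaryless] [LieGroup I' ∞ G]
  [ContMDiffSMul I' I ∞ G M] in
/-- The transport along `1 • x = x` in the definition of `fundamentalField` is invisible once all
tangent spaces are read as `E`. -/
theorem fundamentalField_eq (ξ : GroupLieAlgebra I' G) (x : M) :
    @Eq E (fundamentalField I' I ξ x) (mfderiv I' I (fun a : G => a • x) 1 ξ) := by
  have key : ∀ (y z : M) (h : y = z) (v : TangentSpace I y),
      @Eq E (h ▸ v : TangentSpace I z) v := by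
    rintro y _ rfl v
    rfl
  exact key _ _ (one_smul G x) _

theorem mdifferentiableAt_smul_const (a : G) (x : M) :
    MDifferentiableAt I' I (fun a : G => a • x) a := by
  have h : ContMDiff I' I ∞ (fun a : G => a • x) :=
    (contMDiff_smul (I := I') (I' := I) (n := ∞)).comp (contMDiff_id.prodMk contMDiff_const)
  exact h.mdifferentiable (by simp) a

include I' in
/-- The smoothness of the action of one element, with the model of `G` as an explicit argument. -/
theorem contMDiff_const_smul' (a : G) : ContMDiff I I ∞ (fun y : M => a • y) :=
  ContMDiffSMul.contMDiff_const_smul (I := I') (I' := I) a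

include I' in
theorem mdifferentiableAt_const_smul (a : G) (x : M) :
    MDifferentiableAt I I (fun y : M => a • y) x :=
  (contMDiff_const_smul' I' a).mdifferentiable (by simp) x

include I' in
/-- The differential of the action of `a` is inverted by the differential of the action
of `a⁻¹`. -/
theorem mfderiv_inv_smul_mfderiv_smul (a : G) (x : M) (u : TangentSpace I x) :
    @Eq E (mfderiv I I (fun y : M => a⁻¹ • y) (a • x)
      (mfderiv I I (fun y : M => a • y) x u)) u := by
  have h := mfderiv_comp_apply (I := I) (I' := I) (I'' := I) x (f := fun y : M => a • y)
    (g := fun y : M => a⁻¹ • y)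
    (mdifferentiableAt_const_smul I' a⁻¹ (a • x)) (mdifferentiableAt_const_smul I' a x) u
  have h2 : (fun y : M => a⁻¹ • y) ∘ (fun y : M => a • y) = id := by
    ext y; simp
  rw [h2] at h
  have h3 : @Eq E (mfderiv I I (id : M → M) x u) u := by
    rw [mfderiv_id]; rfl
  exact Eq.trans h.symm h3

include I' in
theorem mfderiv_smul_mfderiv_inv_smul (a : G) (x : M) (u : TangentSpace I (a • x)) :
    @Eq E (mfderiv I I (fun y : M => a • y) x
      (mfderiv I I (fun y : M => a⁻¹ • y) (a • x) u)) u := by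
  have h := mfderiv_comp_apply_of_eq (I := I) (I' := I) (I'' := I) (a • x)
    (g := fun y : M => a • y) (f := fun y : M => a⁻¹ • y) (y := x)
    (mdifferentiableAt_const_smul I' a x) (mdifferentiableAt_const_smul I' a⁻¹ (a • x))
    (by simp) u
  have h2 : (fun y : M => a • y) ∘ (fun y : M => a⁻¹ • y) = id := by
    ext y; simp
  rw [h2] at h
  have h3 : @Eq E (mfderiv I I (id : M → M) (a • x) u) u := by
    rw [mfderiv_id]; rfl
  exact Eq.trans h.symm h3

include I' in
theorem isInvertible_mfderiv_smul (a : G) (x : M) :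
    (mfderiv I I (fun y : M => a • y) x).IsInvertible := by
  refine ContinuousLinearMap.IsInvertible.of_inverse
    (g := mfderiv I I (fun y : M => a⁻¹ • y) (a • x)) ?_ ?_
  · ext u
    exact mfderiv_smul_mfderiv_inv_smul I' a x u
  · ext u
    exact mfderiv_inv_smul_mfderiv_smul I' a x u

include I' in
theorem mfderiv_smul_mpullback (a : G) (V : ∀ y : M, TangentSpace I y) (x : M) :
    mfderiv I I (fun y : M => a • y) x (VectorField.mpullback I I (fun y : M => a • y) V x)
      = V (a • x) := by
  have h := isInvertible_mfderiv_smul I' (I := I) a x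
  rw [VectorField.mpullback_apply]
  exact (h.inverse_apply_eq.1 rfl).symm

theorem mfderiv_groupParam_smul (ξ : F) (x : M) :
    @Eq E (mfderiv 𝓘(ℝ, F) I (fun p : F => groupParam I' G p • x) 0 ξ)
      (fundamentalField I' I (G := G) ξ x) := by
  have h := mfderiv_comp_apply_of_eq (I := 𝓘(ℝ, F)) (I' := I') (I'' := I) (0 : F)
    (g := fun a : G => a • x) (f := groupParam I' G) (y := 1) (mdifferentiableAt_smul_const I' 1 x)
    (hasMFDerivAt_groupParam I' G).mdifferentiableAt (groupParam_zero I' G) ξ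
  refine Eq.trans h (Eq.trans ?_ (fundamentalField_eq I' (G := G) ξ x).symm)
  rw [(hasMFDerivAt_groupParam I' G).mfderiv]
  rfl

theorem contMDiffAt_groupParam_smul (x : M) :
    ContMDiffAt (𝓘(ℝ, F).prod I) I ∞ (fun q : F × M => groupParam I' G q.1 • q.2) (0, x) := by
  have h1 : ContMDiffAt (𝓘(ℝ, F).prod I) I' ∞ (fun q : F × M => groupParam I' G q.1) (0, x) :=
    ContMDiffAt.comp (I' := 𝓘(ℝ, F)) ((0 : F), x) (f := Prod.fst) (g := groupParam I' G)
      (contMDiffAt_groupParam I' G) contMDiffAt_fst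
  exact ContMDiffAt.comp (I' := I'.prod I) ((0 : F), x)
    (f := fun q : F × M => (groupParam I' G q.1, q.2)) (g := fun q : G × M => q.1 • q.2)
    (contMDiff_smul (I := I') (I' := I) (n := ∞)).contMDiffAt (h1.prodMk contMDiffAt_snd)

/-- The derivative at the identity of the pullbacks of a vector field under the action of the
group is the bracket with the fundamental field. -/
theorem hasFDerivAt_mpullback_smul {V : ∀ y : M, TangentSpace I y} (hV : IsSmoothField I V)
    (x : M) :
    ∃ A : F →L[ℝ] E,
      HasFDerivAt (fun p : F =>
        (VectorField.mpullback I I (fun y : M => groupParam I' G p • y) V x : E)) A 0 ∧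
      ∀ ξ : F, @Eq E (A ξ) (VectorField.mlieBracket I (fundamentalField I' I (G := G) ξ) V x) := by
  refine hasFDerivAt_mpullback_family (α := fun p y => groupParam I' G p • y)
    (X := fun ξ => fundamentalField I' I (G := G) ξ)
    ((contMDiffAt_groupParam_smul I' x).of_le ENat.LEInfty.out) (fun y => ?_)
    (hV.mdifferentiable (by simp) x) (fun ξ y => (mfderiv_groupParam_smul I' ξ y).symm)
  simp [groupParam_zero]

/-- The analogue of `hasFDerivAt_mpullback_smul` for functions. -/
theorem hasFDerivAt_comp_groupParam_smul {f : M → ℝ} {x : M}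
    (hf : MDifferentiableAt I 𝓘(ℝ, ℝ) f x) :
    ∃ A : F →L[ℝ] ℝ, HasFDerivAt (fun p : F => f (groupParam I' G p • x)) A 0 ∧
      ∀ ξ : F, A ξ = mvfderiv I f x (fundamentalField I' I (G := G) ξ x) := by
  have hc : MDifferentiableAt 𝓘(ℝ, F) I (fun p : F => groupParam I' G p • x) 0 :=
    MDifferentiableAt.comp_of_eq (0 : F) (g := fun a : G => a • x) (f := groupParam I' G) (y := 1)
      (mdifferentiableAt_smul_const I' 1 x) (hasMFDerivAt_groupParam I' G).mdifferentiableAt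
      (groupParam_zero I' G)
  have h0 : groupParam I' G 0 • x = x := by simp [groupParam_zero]
  have hcomp : MDifferentiableAt 𝓘(ℝ, F) 𝓘(ℝ, ℝ) (fun p : F => f (groupParam I' G p • x)) 0 :=
    MDifferentiableAt.comp_of_eq (0 : F) (g := f) hf hc h0
  refine ⟨fderiv ℝ (fun p : F => f (groupParam I' G p • x)) 0,
    hcomp.differentiableAt.hasFDerivAt, fun ξ => ?_⟩
  have h := mfderiv_comp_apply_of_eq (I := 𝓘(ℝ, F)) (I' := I) (I'' := 𝓘(ℝ, ℝ)) (0 : F)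
    (g := f) (f := fun p : F => groupParam I' G p • x) (y := x) hf hc h0 ξ
  have h2 : @Eq ℝ (mfderiv 𝓘(ℝ, F) 𝓘(ℝ, ℝ) (f ∘ fun p : F => groupParam I' G p • x) 0 ξ)
      (fderiv ℝ (fun p : F => f (groupParam I' G p • x)) 0 ξ) := by
    rw [mfderiv_eq_fderiv]; rfl
  refine Eq.trans h2.symm (Eq.trans h ?_)
  have h3 := mfderiv_groupParam_smul I' (G := G) ξ x (I := I)
  obtain ⟨v, hv⟩ : ∃ v : E, v = mfderiv 𝓘(ℝ, F) I (fun p : F => groupParam I' G p • x) 0 ξ :=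
    ⟨_, rfl⟩
  rw [← hv] at h3
  show (mfderiv I 𝓘(ℝ, ℝ) f x : E → ℝ) _ = (mfderiv I 𝓘(ℝ, ℝ) f x : E → ℝ) _
  congr 1
  exact hv.symm.trans h3

end Action

/-! ### Lie derivatives of invariant forms -/

section Invariant

variable {E : Type*} [NormedAddCommGroup E] [NormedSpace ℝ E] [CompleteSpace E]
  {H : Type*} [TopologicalSpace H] {I : ModelWithCorners ℝ E H} [I.Boundaryless]
  {M : Type*} [TopologicalSpace M] [ChartedSpace H M] [IsManifold I ∞ M]
  {F : Type*} [NormedAddCommGroup F] [NormedSpace ℝ F]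
  {H' : Type*} [TopologicalSpace H'] (I' : ModelWithCorners ℝ F H') [I'.Boundaryless]
  {G : Type*} [TopologicalSpace G] [ChartedSpace H' G] [Group G] [LieGroup I' ∞ G]
  [MulAction G M] [ContMDiffSMul I' I ∞ G M]

/-- The fundamental field is the composition of the differential of the action map `G × M → M` with
the smooth section `x ↦ (ξ, 0)` over `x ↦ (1, x)`. -/
theorem isSmoothField_fundamentalField (ξ : GroupLieAlgebra I' G) :
    IsSmoothField I (fundamentalField I' I (M := M) ξ) := by
  let fg : M → TangentBundle I' G := fun _ => Bundle.TotalSpace.mk' F 1 ξ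
  have sfg : ContMDiff I I'.tangent ∞ fg := contMDiff_const
  let fv : M → TangentBundle I M := fun x => Bundle.TotalSpace.mk' E x 0
  have sfv : ContMDiff I I.tangent ∞ fv := Bundle.contMDiff_zeroSection _ _
  let F₁ : M → (TangentBundle I' G × TangentBundle I M) := fun x => (fg x, fv x)
  have S₁ : ContMDiff I (I'.tangent.prod I.tangent) ∞ F₁ := sfg.prodMk sfv
  let F₂ : (TangentBundle I' G × TangentBundle I M) → TangentBundle (I'.prod I) (G × M) :=
    (equivTangentBundleProd I' G I M).symm
  have S₂ : ContMDiff (I'.tangent.prod I.tangent) (I'.prod I).tangent ∞ F₂ :=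
    contMDiff_equivTangentBundleProd_symm
  let F₃ : TangentBundle (I'.prod I) (G × M) → TangentBundle I M :=
    tangentMap (I'.prod I) I (fun p : G × M => p.1 • p.2)
  have S₃ : ContMDiff (I'.prod I).tangent I.tangent ∞ F₃ := by
    apply ContMDiff.contMDiff_tangentMap (n := ∞) _ (m := ∞) (by simp)
    exact contMDiff_smul (I := I') (I' := I) (n := ∞)
  have S := (S₃.comp S₂).comp S₁
  have heq : (fun x => Bundle.TotalSpace.mk' E x (fundamentalField I' I (M := M) ξ x))
      = (F₃ ∘ F₂) ∘ F₁ := by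
    funext x
    have h0 : ((F₃ ∘ F₂) ∘ F₁) x = ⟨(1 : G) • x,
        mfderiv (I'.prod I) I (fun p : G × M => p.1 • p.2) (1, x) (ξ, (0 : E))⟩ := rfl
    have h3 : mfderiv (I'.prod I) I (fun p : G × M => p.1 • p.2) ((1 : G), x) (ξ, (0 : E))
        = mfderiv I' I (fun a : G => a • x) 1 ξ := by
      have h1 := mfderiv_prod_eq_add_apply (I := I') (I' := I) (I'' := I)
        (f := fun p : G × M => p.1 • p.2) (p := ((1 : G), x)) (v := (ξ, (0 : E)))
        ((contMDiff_smul (I := I') (I' := I) (n := ∞)).mdifferentiable (by simp) _)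
      have h2 : mfderiv I I (fun y : M => (1 : G) • y) x (0 : TangentSpace I x) = 0 := map_zero _
      refine h1.trans ?_
      refine Eq.trans (congrArg (fun w => mfderiv I' I (fun a : G => a • x) 1 ξ + w) h2) ?_
      exact add_zero _
    rw [h0, h3]
    have key : ∀ (y z : M) (h : y = z) (v : TangentSpace I y),
        (⟨z, h ▸ v⟩ : TangentBundle I M) = ⟨y, v⟩ := by
      rintro y _ rfl v
      rfl
    exact key _ _ (one_smul G x) _
  unfold IsSmoothField
  rw [heq]
  exact S

/-- A one-form that is preserved by the action of every element of `G`. -/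
def PreservesOneForm (I : ModelWithCorners ℝ E H) (G : Type*) {M : Type*} [TopologicalSpace M]
    [ChartedSpace H M] [Group G] [MulAction G M]
    (θ : ∀ x : M, TangentSpace I x →L[ℝ] ℝ) : Prop :=
  ∀ (a : G) (x : M) (u : TangentSpace I x),
    θ (a • x) (mfderiv I I (fun y : M => a • y) x u) = θ x u

/-- A two-form that is preserved by the action of every element of `G`. -/
def PreservesTwoForm (I : ModelWithCorners ℝ E H) (G : Type*) {M : Type*} [TopologicalSpace M]
    [ChartedSpace H M] [Group G] [MulAction G M]
    (Ω : ∀ x : M, TangentSpace I x →L[ℝ] TangentSpace I x →L[ℝ] ℝ) : Prop :=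
  ∀ (a : G) (x : M) (u v : TangentSpace I x),
    Ω (a • x) (mfderiv I I (fun y : M => a • y) x u) (mfderiv I I (fun y : M => a • y) x v)
      = Ω x u v

/-- A vector field that is preserved by the action of every element of `G`. -/
def PreservesField (I : ModelWithCorners ℝ E H) (G : Type*) {M : Type*} [TopologicalSpace M]
    [ChartedSpace H M] [Group G] [MulAction G M]
    (V : ∀ x : M, TangentSpace I x) : Prop :=
  ∀ (a : G) (x : M), mfderiv I I (fun y : M => a • y) x (V x) = V (a • x)

/-- The Lie derivative of an invariant one-form along a fundamental field vanishes. -/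
theorem mvfderiv_oneForm_fundamentalField {θ : ∀ x : M, TangentSpace I x →L[ℝ] ℝ}
    (hθ : PreservesOneForm I G θ) {V : ∀ x : M, TangentSpace I x} (hV : IsSmoothField I V) {x : M}
    (hd : MDifferentiableAt I 𝓘(ℝ, ℝ) (fun y => θ y (V y)) x) (ξ : GroupLieAlgebra I' G) :
    mvfderiv I (fun y => θ y (V y)) x (fundamentalField I' I ξ x)
      = θ x (VectorField.mlieBracket I (fundamentalField I' I ξ) V x) := by
  obtain ⟨A, hA, hA'⟩ := hasFDerivAt_mpullback_smul I' (G := G) hV x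
  obtain ⟨B, hB, hB'⟩ := hasFDerivAt_comp_groupParam_smul I' (G := G) hd
  obtain ⟨T, hT⟩ : ∃ T : E →L[ℝ] ℝ, T = θ x := ⟨_, rfl⟩
  -- by invariance the form may be evaluated at `x` on the pulled back field
  have heq : (fun p : F => θ (groupParam I' G p • x) (V (groupParam I' G p • x)))
      = fun p : F =>
        T (VectorField.mpullback I I (fun y : M => groupParam I' G p • y) V x : E) := by
    funext p
    rw [hT, ← mfderiv_smul_mpullback I' (groupParam I' G p) V x]
    exact hθ _ _ _
  have hB2 : HasFDerivAt
      (fun p : F => T (VectorField.mpullback I I (fun y : M => groupParam I' G p • y) V x : E))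
      B 0 := by
    rw [← heq]; exact hB
  have hB3 := hB2.unique (T.hasFDerivAt.comp (0 : F) hA)
  have h : ∀ η : F, B η = T (A η) := fun η => by rw [hB3]; rfl
  exact (hB' ξ).symm.trans ((h ξ).trans ((congrArg T (hA' ξ)).trans (by rw [hT]; rfl)))

/-- The Lie derivative of an invariant two-form along a fundamental field vanishes. -/
theorem mvfderiv_twoForm_fundamentalField
    {Ω : ∀ x : M, TangentSpace I x →L[ℝ] TangentSpace I x →L[ℝ] ℝ}
    (hΩ : PreservesTwoForm I G Ω) {V W : ∀ x : M, TangentSpace I x} (hV : IsSmoothField I V)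
    (hW : IsSmoothField I W) {x : M}
    (hd : MDifferentiableAt I 𝓘(ℝ, ℝ) (fun y => Ω y (V y) (W y)) x) (ξ : GroupLieAlgebra I' G) :
    mvfderiv I (fun y => Ω y (V y) (W y)) x (fundamentalField I' I ξ x)
      = Ω x (VectorField.mlieBracket I (fundamentalField I' I ξ) V x) (W x)
        + Ω x (V x) (VectorField.mlieBracket I (fundamentalField I' I ξ) W x) := by
  obtain ⟨A, hA, hA'⟩ := hasFDerivAt_mpullback_smul I' (G := G) hV x
  obtain ⟨A₂, hA₂, hA₂'⟩ := hasFDerivAt_mpullback_smul I' (G := G) hW x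
  obtain ⟨B, hB, hB'⟩ := hasFDerivAt_comp_groupParam_smul I' (G := G) hd
  obtain ⟨T, hT⟩ : ∃ T : E →L[ℝ] E →L[ℝ] ℝ, T = Ω x := ⟨_, rfl⟩
  -- the pullbacks of the two fields, as curves in the fixed space `E`
  obtain ⟨P, hP⟩ : ∃ P : F → E,
      P = fun p : F => VectorField.mpullback I I (fun y : M => groupParam I' G p • y) V x :=
    ⟨_, rfl⟩
  obtain ⟨Q, hQ⟩ : ∃ Q : F → E,
      Q = fun p : F => VectorField.mpullback I I (fun y : M => groupParam I' G p • y) W x :=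
    ⟨_, rfl⟩
  rw [← hP] at hA
  rw [← hQ] at hA₂
  have heq : (fun p : F => Ω (groupParam I' G p • x) (V (groupParam I' G p • x))
        (W (groupParam I' G p • x))) = fun p : F => T (P p) (Q p) := by
    funext p
    rw [hT, hP, hQ, ← mfderiv_smul_mpullback I' (groupParam I' G p) V x,
      ← mfderiv_smul_mpullback I' (groupParam I' G p) W x]
    exact hΩ _ _ _ _
  have hB2 : HasFDerivAt (fun p : F => T (P p) (Q p)) B 0 := by
    rw [← heq]; exact hB
  have hTP : HasFDerivAt (fun p => T (P p)) (T.comp A) 0 := T.hasFDerivAt.comp (0 : F) hA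
  have hB3 := hB2.unique (hTP.clm_apply hA₂)
  have hone : ∀ (U : ∀ x : M, TangentSpace I x),
      @Eq E (VectorField.mpullback I I (fun y : M => groupParam I' G 0 • y) U x) (U x) := by
    intro U
    have h1 : (fun y : M => groupParam I' G 0 • y) = id := by
      funext y; simp [groupParam_zero]
    rw [h1, VectorField.mpullback_id]
  have hP0 : P 0 = V x := by rw [hP]; exact hone V
  have hQ0 : Q 0 = W x := by rw [hQ]; exact hone W
  have h : ∀ η : F, B η = T (A η) (Q 0) + T (P 0) (A₂ η) := fun η => by
    rw [hB3]; exact add_comm _ _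
  refine (hB' ξ).symm.trans ((h ξ).trans ?_)
  rw [hP0, hQ0, hT]
  exact congrArg₂ (fun u v : E => (Ω x : E →L[ℝ] E →L[ℝ] ℝ) u (W x)
    + (Ω x : E →L[ℝ] E →L[ℝ] ℝ) (V x) v) (hA' ξ) (hA₂' ξ)

end Invariant

/-! ### Functions with zero differential -/

section LocallyConstant

variable {E : Type*} [NormedAddCommGroup E] [NormedSpace ℝ E]
  {H : Type*} [TopologicalSpace H] {I : ModelWithCorners ℝ E H} [I.Boundaryless]
  {M : Type*} [TopologicalSpace M] [ChartedSpace H M] [IsManifold I ∞ M]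
  {E' : Type*} [NormedAddCommGroup E'] [NormedSpace ℝ E']

theorem eventually_eq_of_hasMFDerivAt_zero {f : M → E'} {x : M}
    (h : ∀ᶠ y in 𝓝 x, HasMFDerivAt I 𝓘(ℝ, E') f y 0) : ∀ᶠ y in 𝓝 x, f y = f x := by
  have : IsManifold I 1 M := IsManifold.of_le (n := ∞) (by simp)
  set φ := extChartAt I x with hφ
  have hsymm0 : φ.symm (φ x) = x := extChartAt_to_inv x
  have h1 : ∀ᶠ z in 𝓝 (φ x), HasFDerivAt (f ∘ φ.symm) (0 : E →L[ℝ] E') z := by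
    have hc : ContinuousAt φ.symm (φ x) := continuousAt_extChartAt_symm x
    have h2 : ∀ᶠ z in 𝓝 (φ x), HasMFDerivAt I 𝓘(ℝ, E') f (φ.symm z) 0 := by
      refine hc.eventually (p := fun y => HasMFDerivAt I 𝓘(ℝ, E') f y 0) ?_
      rw [hsymm0]; exact h
    filter_upwards [h2, extChartAt_target_mem_nhds (I := I) x,
      eventually_mem_nhds_iff.2 (extChartAt_target_mem_nhds (I := I) x)] with z hz hzt hzn
    have hd : MDifferentiableAt 𝓘(ℝ, E) I φ.symm z :=
      ((contMDiffOn_extChartAt_symm (n := 1) x).contMDiffAt hzn).mdifferentiableAt (by simp)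
    obtain ⟨L, hL⟩ : ∃ L : E →L[ℝ] E, L = mfderiv 𝓘(ℝ, E) I φ.symm z := ⟨_, rfl⟩
    have hd' : HasMFDerivAt 𝓘(ℝ, E) I φ.symm z L := by rw [hL]; exact hd.hasMFDerivAt
    have h3 : HasMFDerivAt 𝓘(ℝ, E) 𝓘(ℝ, E') (f ∘ φ.symm) z (0 : E →L[ℝ] E') :=
      HasMFDerivAt.comp z (g := f) (f := φ.symm) hz hd'
    exact hasMFDerivAt_iff_hasFDerivAt.1 h3
  obtain ⟨r, hr, hball⟩ := Metric.eventually_nhds_iff_ball.1 h1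
  have hconst : ∀ z ∈ Metric.ball (φ x) r, f (φ.symm z) = f x := by
    intro z hz
    have := Metric.isOpen_ball.is_const_of_fderiv_eq_zero (𝕜 := ℝ) (f := f ∘ φ.symm)
      (convex_ball (φ x) r).isPreconnected
      (fun w hw => (hball w hw).differentiableAt.differentiableWithinAt)
      (fun w hw => (hball w hw).fderiv) hz (Metric.mem_ball_self hr)
    simpa [hsymm0] using this
  have hcφ : ContinuousAt φ x := continuousAt_extChartAt x
  filter_upwards [hcφ.eventually (Metric.ball_mem_nhds (φ x) hr),
    extChartAt_source_mem_nhds (I := I) x] with y hy hys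
  have := hconst _ hy
  rwa [φ.left_inv hys] at this

theorem eq_of_hasMFDerivAt_zero [PreconnectedSpace M] {f : M → E'}
    (h : ∀ y, HasMFDerivAt I 𝓘(ℝ, E') f y 0) (x y : M) : f x = f y := by
  have : IsLocallyConstant f := by
    rw [IsLocallyConstant.iff_eventually_eq]
    exact fun x => eventually_eq_of_hasMFDerivAt_zero (Filter.Eventually.of_forall h)
  exact this.apply_eq_of_preconnectedSpace x y

end LocallyConstant

/-! ### The adjoint action -/

section Adjoint

variable {F : Type*} [NormedAddCommGroup F] [NormedSpace ℝ F] [CompleteSpace F]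
  {H' : Type*} [TopologicalSpace H'] (I' : ModelWithCorners ℝ F H') [I'.Boundaryless]
  {G : Type*} [TopologicalSpace G] [ChartedSpace H' G] [Group G] [LieGroup I' ∞ G]

theorem mdifferentiableAt_mul_left (a b : G) : MDifferentiableAt I' I' (fun y : G => a * y) b :=
  (contMDiff_mul_left (I := I') (n := ∞) (a := a)).mdifferentiable (by simp) b

theorem mdifferentiableAt_mul_right (a b : G) : MDifferentiableAt I' I' (fun y : G => y * a) b :=
  (contMDiff_mul_right (I := I') (n := ∞) (a := a)).mdifferentiable (by simp) b

theorem mdifferentiableAt_conj (a b : G) :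
    MDifferentiableAt I' I' (fun y : G => a * y * a⁻¹) b :=
  MDifferentiableAt.comp b (g := fun y : G => y * a⁻¹) (f := fun y : G => a * y)
    (mdifferentiableAt_mul_right I' _ _) (mdifferentiableAt_mul_left I' _ _)

/-- The adjoint action of `a : G` on the Lie algebra: the differential at `1` of the conjugation
by `a`. -/
def adjoint (a : G) : F →L[ℝ] F := mfderiv I' I' (fun y : G => a * y * a⁻¹) 1

theorem adjoint_one (Z : F) : adjoint I' (1 : G) Z = Z := by
  have h : (fun y : G => 1 * y * (1 : G)⁻¹) = id := by funext y; simp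
  rw [adjoint, h, mfderiv_id]
  rfl

theorem adjoint_mul (a b : G) (Z : F) :
    adjoint I' (a * b) Z = adjoint I' a (adjoint I' b Z) := by
  have h : (fun y : G => a * b * y * (a * b)⁻¹)
      = (fun y : G => a * y * a⁻¹) ∘ (fun y : G => b * y * b⁻¹) := by
    funext y; simp [mul_assoc]
  have h2 := mfderiv_comp_apply_of_eq (I := I') (I' := I') (I'' := I') (1 : G)
    (g := fun y : G => a * y * a⁻¹) (f := fun y : G => b * y * b⁻¹) (y := 1)
    (mdifferentiableAt_conj I' a 1) (mdifferentiableAt_conj I' b 1) (by simp) Z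
  rw [← h] at h2
  exact h2

theorem mfderiv_mul_right_adjoint (a : G) (Z : F) :
    @Eq F (mfderiv I' I' (fun y : G => y * a) 1 (adjoint I' a Z))
      (mulInvariantVectorField (I := I') Z a) := by
  have h : (fun y : G => a * y) = (fun y : G => y * a) ∘ (fun y : G => a * y * a⁻¹) := by
    funext y; simp
  have h2 := mfderiv_comp_apply_of_eq (I := I') (I' := I') (I'' := I') (1 : G)
    (g := fun y : G => y * a) (f := fun y : G => a * y * a⁻¹) (y := 1)
    (mdifferentiableAt_mul_right I' a 1) (mdifferentiableAt_conj I' a 1) (by simp) Z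
  rw [← h] at h2
  exact h2.symm

theorem isInvertible_mfderiv_mul_right (a : G) :
    (mfderiv I' I' (fun y : G => y * a) (1 : G)).IsInvertible := by
  have key : ∀ (a b y : G), b * a = y → ∀ v : F,
      @Eq F (mfderiv I' I' (fun y : G => y * a⁻¹) y
        (mfderiv I' I' (fun y : G => y * a) b v)) v := by
    intro a b y hy v
    have h2 := mfderiv_comp_apply_of_eq (I := I') (I' := I') (I'' := I') b
      (g := fun y : G => y * a⁻¹) (f := fun y : G => y * a) (y := y)
      (mdifferentiableAt_mul_right I' _ _) (mdifferentiableAt_mul_right I' a b) hy v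
    have h : (fun y : G => y * a⁻¹) ∘ (fun y : G => y * a) = id := by
      funext y; simp
    rw [h] at h2
    have h3 : @Eq F (mfderiv I' I' (id : G → G) b v) v := by rw [mfderiv_id]; rfl
    exact h2.symm.trans h3
  refine ContinuousLinearMap.IsInvertible.of_inverse
    (g := mfderiv I' I' (fun y : G => y * a⁻¹) (1 * a)) ?_ ?_
  · ext v
    have := key a⁻¹ (1 * a) 1 (by simp) v
    rw [inv_inv] at this
    exact this
  · ext v
    exact key a 1 (1 * a) rfl v

/-- The pullback of a left-invariant field under a right translation is the left-invariant field of
its image under the adjoint action; here at the identity. -/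
theorem mpullback_mul_right_mulInvariantVectorField (a : G) (Z : F) :
    @Eq F (VectorField.mpullback I' I' (fun y : G => y * a) (mulInvariantVectorField (I := I') Z) 1)
      (adjoint I' a Z) := by
  have h := isInvertible_mfderiv_mul_right I' a
  rw [VectorField.mpullback_apply]
  refine (h.inverse_apply_eq.2 ?_)
  have h2 := mfderiv_mul_right_adjoint I' a Z
  have key : ∀ b c : G, b = c → @Eq F (mulInvariantVectorField (I := I') Z b)
      (mulInvariantVectorField (I := I') Z c) := by
    rintro b _ rfl
    rfl
  exact (key _ _ (one_mul a)).trans h2.symm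

/-- The derivative of the adjoint action at the identity is the Lie bracket: right translations
are a family of maps whose first-order variations are the left-invariant fields. -/
theorem hasFDerivAt_adjoint (Z : F) :
    ∃ A : F →L[ℝ] F, HasFDerivAt (fun p : F => adjoint I' (groupParam I' G p) Z) A 0 ∧
      ∀ ξ : F, A ξ = @Bracket.bracket (GroupLieAlgebra I' G) (GroupLieAlgebra I' G) _ ξ Z := by
  have hα : ContMDiffAt (𝓘(ℝ, F).prod I') I' ∞
      (fun q : F × G => q.2 * groupParam I' G q.1) (0, 1) := by
    have h1 : ContMDiffAt (𝓘(ℝ, F).prod I') I' ∞ (fun q : F × G => groupParam I' G q.1) (0, 1) :=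
      ContMDiffAt.comp (I' := 𝓘(ℝ, F)) ((0 : F), (1 : G)) (f := Prod.fst) (g := groupParam I' G)
        (contMDiffAt_groupParam I' G) contMDiffAt_fst
    exact contMDiffAt_snd.mul h1
  obtain ⟨A, hA, hA'⟩ := hasFDerivAt_mpullback_family (I := I') (x := (1 : G))
    (α := fun p y => y * groupParam I' G p) (V := mulInvariantVectorField (I := I') Z)
    (X := fun ξ => mulInvariantVectorField (I := I') ξ) (hα.of_le ENat.LEInfty.out)
    (fun y => by simp [groupParam_zero])
    (mdifferentiableAt_mulInvariantVectorField (I := I') Z)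
    (fun ξ y => by
      have h := mfderiv_comp_apply_of_eq (I := 𝓘(ℝ, F)) (I' := I') (I'' := I') (0 : F)
        (g := fun b : G => y * b) (f := groupParam I' G) (y := 1)
        (mdifferentiableAt_mul_left I' y 1)
        (hasMFDerivAt_groupParam I' G).mdifferentiableAt (groupParam_zero I' G) ξ
      refine Eq.trans ?_ h.symm
      rw [(hasMFDerivAt_groupParam I' G).mfderiv]
      rfl)
  refine ⟨A, ?_, hA'⟩
  have : (fun p : F => adjoint I' (groupParam I' G p) Z)
      = fun p : F => (VectorField.mpullback I' I' (fun y : G => y * groupParam I' G p)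
        (mulInvariantVectorField (I := I') Z) 1 : F) := by
    funext p
    exact (mpullback_mul_right_mulInvariantVectorField I' _ Z).symm
  rw [this]
  exact hA

/-- The adjoint action of a connected group is trivial on the centre of the Lie algebra: the
function `a ↦ Ad(a) Z` has zero differential at `1`, hence everywhere, because `Ad` is
multiplicative. -/
theorem adjoint_eq_self_of_mem_center [PreconnectedSpace G] {Z : GroupLieAlgebra I' G}
    (hZ : Z ∈ LieAlgebra.center ℝ (GroupLieAlgebra I' G)) (a : G) : adjoint I' a Z = Z := by
  have : IsManifold I' 1 G := IsManifold.of_le (n := ∞) (by simp)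
  obtain ⟨A, hA, hA'⟩ := hasFDerivAt_adjoint I' (G := G) Z
  have hA0 : A = 0 := by
    ext ξ
    refine (hA' ξ).trans ?_
    exact (LieModule.mem_maxTrivSubmodule _ _ _ _).1 hZ ξ
  rw [hA0] at hA
  refine (eq_of_hasMFDerivAt_zero (I := I') (f := fun a : G => adjoint I' a Z) (fun b => ?_) a
    1).trans (adjoint_one I' Z)
  have h1 : HasFDerivAt (fun p : F => adjoint I' b (adjoint I' (groupParam I' G p) Z))
      (0 : F →L[ℝ] F) 0 := by
    have := (adjoint I' b).hasFDerivAt.comp (0 : F) hA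
    rw [ContinuousLinearMap.comp_zero] at this
    exact this
  -- near `b` the function is `p ↦ Ad(b) Ad(groupParam p) Z` after the translated chart
  set ψ := extChartAt I' (1 : G) with hψ
  have hψd : MDifferentiableAt I' 𝓘(ℝ, F) ψ 1 :=
    mdifferentiableAt_extChartAt (mem_chart_source H' 1)
  have h2 : MDifferentiableAt I' 𝓘(ℝ, F) (fun y : G => ψ (b⁻¹ * y) - ψ 1) b := by
    have h3 : MDifferentiableAt I' 𝓘(ℝ, F) (fun y : G => ψ (b⁻¹ * y)) b :=
      MDifferentiableAt.comp_of_eq b (g := ψ) (f := fun y : G => b⁻¹ * y) (y := 1) hψd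
        (mdifferentiableAt_mul_left I' b⁻¹ b) (by simp)
    exact h3.sub mdifferentiableAt_const
  obtain ⟨L, hL⟩ : ∃ L : F →L[ℝ] F, L = mfderiv I' 𝓘(ℝ, F) (fun y : G => ψ (b⁻¹ * y) - ψ 1) b :=
    ⟨_, rfl⟩
  have h2' : HasMFDerivAt I' 𝓘(ℝ, F) (fun y : G => ψ (b⁻¹ * y) - ψ 1) b L := by
    rw [hL]; exact h2.hasMFDerivAt
  have h1' : HasMFDerivAt 𝓘(ℝ, F) 𝓘(ℝ, F)
      (fun p : F => adjoint I' b (adjoint I' (groupParam I' G p) Z)) (ψ (b⁻¹ * b) - ψ 1)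
      (0 : F →L[ℝ] F) := by
    rw [inv_mul_cancel, sub_self]
    exact h1.hasMFDerivAt
  have h4 : HasMFDerivAt I' 𝓘(ℝ, F) ((fun p : F => adjoint I' b (adjoint I' (groupParam I' G p) Z))
      ∘ (fun y : G => ψ (b⁻¹ * y) - ψ 1)) b (0 : F →L[ℝ] F) :=
    HasMFDerivAt.comp b h1' h2'
  refine h4.congr_of_eventuallyEq ?_
  have hc : ContinuousAt (fun y : G => b⁻¹ * y) b :=
    (mdifferentiableAt_mul_left I' b⁻¹ b).continuousAt
  have hs : ∀ᶠ y in 𝓝 b, b⁻¹ * y ∈ ψ.source := by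
    refine hc.eventually (p := fun y => y ∈ ψ.source) ?_
    simp only [inv_mul_cancel]
    exact extChartAt_source_mem_nhds 1
  filter_upwards [hs] with y hy
  have h5 : groupParam I' G (ψ (b⁻¹ * y) - ψ 1) = b⁻¹ * y := by
    rw [groupParam, ← hψ, add_sub_cancel, ψ.left_inv hy]
  simp only [Function.comp_apply, h5]
  have h6 := adjoint_mul I' b (b⁻¹ * y) Z
  rwa [mul_inv_cancel_left] at h6

end Adjoint

/-! ### Fundamental fields of central elements -/

section Central

variable {E : Type*} [NormedAddCommGroup E] [NormedSpace ℝ E] [CompleteSpace E]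
  {H : Type*} [TopologicalSpace H] {I : ModelWithCorners ℝ E H} [I.Boundaryless]
  {M : Type*} [TopologicalSpace M] [ChartedSpace H M] [IsManifold I ∞ M]
  {F : Type*} [NormedAddCommGroup F] [NormedSpace ℝ F] [CompleteSpace F]
  {H' : Type*} [TopologicalSpace H'] (I' : ModelWithCorners ℝ F H') [I'.Boundaryless]
  {G : Type*} [TopologicalSpace G] [ChartedSpace H' G] [Group G] [LieGroup I' ∞ G]
  [MulAction G M] [ContMDiffSMul I' I ∞ G M]

/-- The orbit map `b ↦ b • x` sends the left-invariant field of `ξ` at `a` to the image of the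
fundamental field at `x` under the action of `a`. -/
theorem mfderiv_orbit_mulInvariantVectorField (ξ : GroupLieAlgebra I' G) (a : G) (x : M) :
    @Eq E (mfderiv I' I (fun b : G => b • x) a (mulInvariantVectorField (I := I') ξ a))
      (mfderiv I I (fun y : M => a • y) x (fundamentalField I' I ξ x)) := by
  have h1 := mfderiv_comp_apply_of_eq (I := I') (I' := I') (I'' := I) (1 : G)
    (g := fun b : G => b • x) (f := fun b : G => a * b) (y := a)
    (mdifferentiableAt_smul_const I' a x) (mdifferentiableAt_mul_left I' a 1) (by simp) ξ
  have h2 := mfderiv_comp_apply_of_eq (I := I') (I' := I) (I'' := I) (1 : G)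
    (g := fun y : M => a • y) (f := fun b : G => b • x) (y := x)
    (mdifferentiableAt_const_smul I' a x) (mdifferentiableAt_smul_const I' 1 x) (by simp) ξ
  have h3 : (fun b : G => b • x) ∘ (fun b : G => a * b)
      = (fun y : M => a • y) ∘ (fun b : G => b • x) := by
    funext b; simp [mul_smul]
  rw [h3] at h1
  refine h1.symm.trans (h2.trans ?_)
  exact congrArg (fun v : E => (mfderiv I I (fun y : M => a • y) x : E →L[ℝ] E) v)
    (fundamentalField_eq I' ξ x).symm

/-- The orbit map `b ↦ b • x` sends the right-invariant field of `ξ` to the fundamental field. -/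
theorem mfderiv_orbit_mfderiv_mul_right (ξ : GroupLieAlgebra I' G) (a : G) (x : M) :
    @Eq E (mfderiv I' I (fun b : G => b • x) a (mfderiv I' I' (fun y : G => y * a) 1 ξ))
      (fundamentalField I' I ξ (a • x)) := by
  have h2 := mfderiv_comp_apply_of_eq (I := I') (I' := I') (I'' := I) (1 : G)
    (g := fun b : G => b • x) (f := fun b : G => b * a) (y := a)
    (mdifferentiableAt_smul_const I' a x) (mdifferentiableAt_mul_right I' a 1) (by simp) ξ
  have h3 : (fun b : G => b • x) ∘ (fun b : G => b * a) = fun b : G => b • (a • x) := by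
    funext b; simp [mul_smul]
  rw [h3] at h2
  exact Eq.trans (α := E) h2.symm (fundamentalField_eq (I := I) I' ξ (a • x)).symm

/-- The fundamental field of a central element is invariant, because the adjoint action of a
connected group is trivial on the centre of the Lie algebra. -/
theorem preservesField_fundamentalField [PreconnectedSpace G] {Z : GroupLieAlgebra I' G}
    (hZ : Z ∈ LieAlgebra.center ℝ (GroupLieAlgebra I' G)) :
    PreservesField I G (fundamentalField I' I (M := M) Z) := by
  intro a x
  have h4 : @Eq F (mfderiv I' I' (fun y : G => y * a) 1 Z)
      (mulInvariantVectorField (I := I') Z a) := by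
    have h5 := mfderiv_mul_right_adjoint I' a Z
    have h6 : adjoint I' a Z = Z := adjoint_eq_self_of_mem_center I' hZ a
    refine Eq.trans ?_ h5
    exact congrArg (fun v : F => (mfderiv I' I' (fun y : G => y * a) 1 : F →L[ℝ] F) v) h6.symm
  have h7 : @Eq E (mfderiv I' I (fun b : G => b • x) a (mfderiv I' I' (fun y : G => y * a) 1 Z))
      (mfderiv I' I (fun b : G => b • x) a (mulInvariantVectorField (I := I') Z a)) :=
    congrArg (fun v : F => (mfderiv I' I (fun b : G => b • x) a : F →L[ℝ] E) v) h4
  exact ((mfderiv_orbit_mfderiv_mul_right I' Z a x).symm.trans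
    (h7.trans (mfderiv_orbit_mulInvariantVectorField I' Z a x))).symm

/-- For a faithful action, only the zero element of the Lie algebra has vanishing fundamental
field: the integral curve of its left-invariant field acts trivially. -/
theorem eq_zero_of_fundamentalField_eq_zero [T2Space M] [FaithfulSMul G M]
    {Z : GroupLieAlgebra I' G} (hZ : ∀ x : M, fundamentalField I' I Z x = 0) : Z = 0 := by
  have : IsManifold I 1 M := IsManifold.of_le (n := ∞) (by simp)
  have : IsManifold I' 1 G := IsManifold.of_le (n := ∞) (by simp)
  have hsm : ContMDiff I' I'.tangent 1
      (fun a : G => (⟨a, mulInvariantVectorField (I := I') Z a⟩ : TangentBundle I' G)) := by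
    refine (contMDiff_mulInvariantVectorField (I := I') Z).of_le ?_
    exact le_trans (by norm_num) le_minSmoothness
  obtain ⟨γ, hγ0, hγ⟩ := exists_isMIntegralCurveAt_of_contMDiffAt_boundaryless (I := I') 0
    (hsm.contMDiffAt (x := (1 : G)))
  obtain ⟨ε, hε, hγε⟩ := isMIntegralCurveAt_iff'.1 hγ
  rw [Real.ball_eq_Ioo, zero_sub, zero_add] at hγε
  have h0mem : (0 : ℝ) ∈ Set.Ioo (-ε) ε := ⟨by linarith, hε⟩
  -- both `γ t • x` and `x` are integral curves of the zero field on `M`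
  have hconst : ∀ t ∈ Set.Ioo (-ε) ε, γ t = 1 := by
    intro t ht
    refine FaithfulSMul.eq_of_smul_eq_smul (α := M) fun x => ?_
    have hzero : ContMDiff I I.tangent 1 (fun y : M => (⟨y, 0⟩ : TangentBundle I M)) :=
      Bundle.contMDiff_zeroSection ℝ (TangentSpace I)
    have h1 : IsMIntegralCurveOn (fun t => γ t • x) (fun y : M => (0 : TangentSpace I y))
        (Set.Ioo (-ε) ε) := by
      intro s hs
      obtain ⟨v, hv⟩ : ∃ v : F, v = mulInvariantVectorField (I := I') Z (γ s) := ⟨_, rfl⟩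
      have h2 : HasMFDerivWithinAt 𝓘(ℝ, ℝ) I' γ (Set.Ioo (-ε) ε) s
          ((1 : ℝ →L[ℝ] ℝ).smulRight v) := by
        rw [hv]; exact hγε s hs
      obtain ⟨L, hL⟩ : ∃ L : F →L[ℝ] E, L = mfderiv I' I (fun b : G => b • x) (γ s) := ⟨_, rfl⟩
      have h3 : HasMFDerivAt I' I (fun b : G => b • x) (γ s) L := by
        rw [hL]; exact (mdifferentiableAt_smul_const I' (γ s) x).hasMFDerivAt
      have h4 : HasMFDerivWithinAt 𝓘(ℝ, ℝ) I (fun t => γ t • x) (Set.Ioo (-ε) ε) s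
          (L.comp ((1 : ℝ →L[ℝ] ℝ).smulRight v)) :=
        HasMFDerivAt.comp_hasMFDerivWithinAt s h3 h2
      have h5 : L v = 0 := by
        rw [hL, hv]
        refine (mfderiv_orbit_mulInvariantVectorField I' Z (γ s) x).trans ?_
        rw [hZ x]
        exact map_zero _
      have h6 : L.comp ((1 : ℝ →L[ℝ] ℝ).smulRight v) = (1 : ℝ →L[ℝ] ℝ).smulRight (0 : E) := by
        ext; simp [h5]
      exact h4.congr_mfderiv h6
    have h2 : IsMIntegralCurveOn (fun _ : ℝ => x) (fun y : M => (0 : TangentSpace I y))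
        (Set.Ioo (-ε) ε) := by
      intro s hs
      have h3 : (0 : ℝ →L[ℝ] E) = (1 : ℝ →L[ℝ] ℝ).smulRight (0 : E) := by ext; simp
      exact (hasMFDerivWithinAt_const x _ _).congr_mfderiv h3
    have := isMIntegralCurveOn_Ioo_eqOn_of_contMDiff_boundaryless (I := I) h0mem hzero h1 h2
      (by simp [hγ0]) ht
    simpa using this
  have hd : HasMFDerivAt 𝓘(ℝ, ℝ) I' γ 0
      ((1 : ℝ →L[ℝ] ℝ).smulRight (mulInvariantVectorField (I := I') Z (γ 0) : F)) :=
    hγ.hasMFDerivAt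
  have hd2 : HasMFDerivAt 𝓘(ℝ, ℝ) I' γ 0 (0 : ℝ →L[ℝ] F) := by
    refine (hasMFDerivAt_const (1 : G) (0 : ℝ)).congr_of_eventuallyEq ?_
    filter_upwards [Ioo_mem_nhds h0mem.1 h0mem.2] with t ht
    exact hconst t ht
  have heq := hasMFDerivAt_unique hd hd2
  have h1 : @Eq F (mulInvariantVectorField (I := I') Z (γ 0)) 0 := by
    have h2 := congrArg (fun A : ℝ →L[ℝ] F => A 1) heq
    exact (one_smul ℝ _).symm.trans h2
  have key : ∀ a : G, a = 1 → @Eq F (mulInvariantVectorField (I := I') Z a) Z := by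
    rintro a rfl
    have h3 : (fun b : G => 1 * b) = id := by funext; simp
    rw [mulInvariantVectorField, h3, mfderiv_id]
    rfl
  exact (key _ hγ0).symm.trans h1

end Central

/-! ### Fields which are constant in a chart -/

section CoordinateFields

variable {E : Type*} [NormedAddCommGroup E] [NormedSpace ℝ E] [FiniteDimensional ℝ E]
  {H : Type*} [TopologicalSpace H] (I : ModelWithCorners ℝ E H) [I.Boundaryless]
  {M : Type*} [TopologicalSpace M] [ChartedSpace H M] [IsManifold I ∞ M] [T2Space M]

/-- Around every point there are global smooth vector fields which near that point agree with the
constant fields of a chart. -/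
theorem exists_coordinate_fields (x : M) :
    ∃ U : Set M, IsOpen U ∧ x ∈ U ∧ U ⊆ (extChartAt I x).source ∧
      ∃ V : E → ∀ y : M, TangentSpace I y, (∀ u, IsSmoothField I (V u)) ∧
        ∀ u, ∀ y ∈ U, V u y = VectorField.mpullback I 𝓘(ℝ, E) (extChartAt I x) (fun _ => u) y := by
  have : CompleteSpace E := FiniteDimensional.complete ℝ E
  have : IsManifold I 1 M := IsManifold.of_le (n := ∞) (by simp)
  obtain ⟨ρ⟩ : Nonempty (SmoothBumpFunction I x) := inferInstance
  obtain ⟨U, hU, hUo, hxU⟩ := eventually_nhds_iff.1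
    (ρ.eventuallyEq_one.and (extChartAt_source_mem_nhds (I := I) x))
  -- the coordinate field of the chart, cut off by a bump function
  refine ⟨U, hUo, hxU, fun y hy => (hU y hy).2,
    fun u => (ρ : M → ℝ) • VectorField.mpullback I 𝓘(ℝ, E) (extChartAt I x) (fun _ => u),
    fun u => ?_, fun u y hy => ?_⟩
  · refine ContMDiffOn.smul_section_of_tsupport (u := (chartAt H x).source)
      ρ.contMDiff.contMDiffOn (chartAt H x).open_source ρ.tsupport_subset_chartAt_source ?_
    intro y hy
    refine ContMDiffAt.contMDiffWithinAt ?_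
    have hy' : y ∈ (extChartAt I x).source := by rwa [extChartAt_source]
    refine ContMDiffAt.mpullback_vectorField_preimage (n := ∞) (m := ∞) ?_
      (contMDiffAt_extChartAt' hy) (isInvertible_mfderiv_extChartAt hy') (by simp)
    exact contMDiffAt_vectorSpace_iff_contDiffAt.2 contDiffAt_const
  · have h1 : ρ y = 1 := (hU y hy).1
    simp [h1]

theorem mlieBracket_coordinate_fields {x : M} {U : Set M} (hU : IsOpen U)
    (hUx : U ⊆ (extChartAt I x).source) {V W : ∀ y : M, TangentSpace I y} {u v : E}
    (hV : ∀ y ∈ U, V y = VectorField.mpullback I 𝓘(ℝ, E) (extChartAt I x) (fun _ => u) y)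
    (hW : ∀ y ∈ U, W y = VectorField.mpullback I 𝓘(ℝ, E) (extChartAt I x) (fun _ => v) y)
    {y : M} (hy : y ∈ U) : VectorField.mlieBracket I V W y = 0 := by
  have : CompleteSpace E := FiniteDimensional.complete ℝ E
  have : IsManifold I (minSmoothness ℝ 3) M := by
    rw [minSmoothness_of_isRCLikeNormedField]
    exact IsManifold.of_le (n := ∞) ENat.LEInfty.out
  have h1 : VectorField.mlieBracket I V W y
      = VectorField.mlieBracket I
        (VectorField.mpullback I 𝓘(ℝ, E) (extChartAt I x) (fun _ => u))
        (VectorField.mpullback I 𝓘(ℝ, E) (extChartAt I x) (fun _ => v)) y := by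
    refine Filter.EventuallyEq.mlieBracket_vectorField_eq ?_ ?_
    · filter_upwards [hU.mem_nhds hy] with z hz using hV z hz
    · filter_upwards [hU.mem_nhds hy] with z hz using hW z hz
  have hd : ∀ w : E, MDifferentiableAt 𝓘(ℝ, E) 𝓘(ℝ, E).tangent
      (fun z : E => (⟨z, w⟩ : TangentBundle 𝓘(ℝ, E) E)) (extChartAt I x y) := fun w =>
    (contMDiffAt_vectorSpace_iff_contDiffAt (n := 1).2 contDiffAt_const).mdifferentiableAt (by simp)
  have hys : y ∈ (chartAt H x).source := by
    have := hUx hy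
    rwa [extChartAt_source] at this
  rw [h1, ← VectorField.mpullback_mlieBracket (n := ∞) (hd u) (hd v)
    (contMDiffAt_extChartAt' hys)
    (by rw [minSmoothness_of_isRCLikeNormedField]; exact ENat.LEInfty.out)]
  have h2 : VectorField.mlieBracket 𝓘(ℝ, E) (fun _ : E => u) (fun _ : E => v)
      (extChartAt I x y) = (0 : E) := by
    have h3 := congrFun (VectorField.mlieBracketWithin_eq_lieBracketWithin (𝕜 := ℝ)
      (V := fun _ : E => u) (W := fun _ : E => v) (s := Set.univ)) (extChartAt I x y)
    have h4 := congrFun (VectorField.mlieBracketWithin_univ (I := 𝓘(ℝ, E)) (V := fun _ : E => u)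
      (W := fun _ : E => v)) (extChartAt I x y)
    refine Eq.trans (α := E) h4.symm (Eq.trans (α := E) h3 ?_)
    simp [VectorField.lieBracketWithin]
  rw [VectorField.mpullback_apply]
  refine Eq.trans (congrArg (fun w : E =>
    (mfderiv I 𝓘(ℝ, E) (extChartAt I x) y : E →L[ℝ] E).inverse w) h2) ?_
  exact map_zero _

theorem exists_smooth_field (x : M) (u : TangentSpace I x) :
    ∃ V : ∀ y : M, TangentSpace I y, IsSmoothField I V ∧ V x = u := by
  have : IsManifold I 1 M := IsManifold.of_le (n := ∞) (by simp)
  obtain ⟨U, hU, hxU, hUs, V, hV, hV'⟩ := exists_coordinate_fields I x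
  refine ⟨V u, hV u, (hV' u x hxU).trans ?_⟩
  have key : ∀ Φ : E →L[ℝ] E, Φ = ContinuousLinearMap.id ℝ E → ∀ u : E, Φ.inverse u = u := by
    rintro Φ rfl u; simp
  exact key _ mfderiv_extChartAt_self _

end CoordinateFields

/-! ### Smoothness of contractions -/

section Smoothness

variable {E : Type*} [NormedAddCommGroup E] [NormedSpace ℝ E]
  {H : Type*} [TopologicalSpace H] {I : ModelWithCorners ℝ E H}
  {M : Type*} [TopologicalSpace M] [ChartedSpace H M] [IsManifold I ∞ M]

theorem contMDiff_oneForm_apply {θ : ∀ x : M, TangentSpace I x →L[ℝ] ℝ} (hθ : IsSmoothOneForm I θ)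
    {V : ∀ y : M, TangentSpace I y} (hV : IsSmoothField I V) :
    ContMDiff I 𝓘(ℝ, ℝ) ∞ (fun y => θ y (V y)) := by
  have h := ContMDiff.clm_bundle_apply (E₂ := Bundle.Trivial M ℝ) (b := id) hθ hV
  exact (fun x => ((Bundle.contMDiffAt_totalSpace).1 (h x)).2)

theorem IsSmoothField.applyField {J : ∀ x : M, TangentSpace I x →L[ℝ] TangentSpace I x}
    (hJ : IsSmoothEndo I J) {V : ∀ y : M, TangentSpace I y} (hV : IsSmoothField I V) :
    IsSmoothField I (applyField I J V) :=
  ContMDiff.clm_bundle_apply (b := id) hJ hV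

theorem contMDiff_metric_apply (g : Metric I M) {V W : ∀ y : M, TangentSpace I y}
    (hV : IsSmoothField I V) (hW : IsSmoothField I W) :
    ContMDiff I 𝓘(ℝ, ℝ) ∞ (fun y => g.inner y (V y) (W y)) := by
  have h := ContMDiff.clm_bundle_apply₂ (E₃ := Bundle.Trivial M ℝ) (b := id) g.contMDiff hV hW
  exact (fun x => ((Bundle.contMDiffAt_totalSpace).1 (h x)).2)

theorem contMDiff_fundamentalForm_apply {g : Metric I M}
    {J : ∀ x : M, TangentSpace I x →L[ℝ] TangentSpace I x} (hJ : IsSmoothEndo I J)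
    {V W : ∀ y : M, TangentSpace I y} (hV : IsSmoothField I V) (hW : IsSmoothField I W) :
    ContMDiff I 𝓘(ℝ, ℝ) ∞ (fun y => fundamentalForm g J y (V y) (W y)) :=
  contMDiff_metric_apply g (hV.applyField hJ) hW

end Smoothness

/-! ### Local primitives of closed one-forms -/

section Primitive

theorem differentiableOn_of_forall_apply {D E : Type*} [NormedAddCommGroup D] [NormedSpace ℝ D]
    [NormedAddCommGroup E] [NormedSpace ℝ E] [FiniteDimensional ℝ E] {f : D → E →L[ℝ] ℝ} {s : Set D}
    (h : ∀ u, DifferentiableOn ℝ (fun z => f z u) s) : DifferentiableOn ℝ f s := by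
  have hd : Module.finrank ℝ E = Module.finrank ℝ (Fin (Module.finrank ℝ E) → ℝ) :=
    (Module.finrank_fin_fun ℝ).symm
  let e₁ := ContinuousLinearEquiv.ofFinrankEq hd
  let e₂ := (e₁.arrowCongr (1 : ℝ ≃L[ℝ] ℝ)).trans
    (ContinuousLinearEquiv.piRing (Fin (Module.finrank ℝ E)))
  rw [← Function.id_comp f, ← e₂.symm_comp_self]
  exact e₂.symm.differentiable.comp_differentiableOn (differentiableOn_pi.mpr fun i => h _)

variable {E : Type*} [NormedAddCommGroup E] [NormedSpace ℝ E] [FiniteDimensional ℝ E]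
  {H : Type*} [TopologicalSpace H] {I : ModelWithCorners ℝ E H} [I.Boundaryless]
  {M : Type*} [TopologicalSpace M] [ChartedSpace H M] [IsManifold I ∞ M] [T2Space M]

/-- The Poincaré lemma: a closed one-form is locally the differential of a function. -/
theorem exists_local_primitive {θ : ∀ x : M, TangentSpace I x →L[ℝ] ℝ} (hθ : IsSmoothOneForm I θ)
    (hc : ∀ X Y : (∀ x : M, TangentSpace I x), IsSmoothField I X → IsSmoothField I Y →
      ∀ x, extDerivOne I θ X Y x = 0) (x : M) :
    ∃ U : Set M, IsOpen U ∧ x ∈ U ∧ IsPreconnected U ∧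
      ∃ f : M → ℝ, ∀ y ∈ U, HasMFDerivAt I 𝓘(ℝ, ℝ) f y (θ y) := by
  have : CompleteSpace E := FiniteDimensional.complete ℝ E
  have : IsManifold I 1 M := IsManifold.of_le (n := ∞) (by simp)
  obtain ⟨U, hU, hxU, hUs, V, hV, hV'⟩ := exists_coordinate_fields I x
  set φ := extChartAt I x with hφ
  have hsymm0 : φ.symm (φ x) = x := extChartAt_to_inv x
  have hnear : ∀ᶠ z in 𝓝 (φ x), z ∈ φ.target ∧ φ.symm z ∈ U := by
    refine Filter.Eventually.and (extChartAt_target_mem_nhds (I := I) x) ?_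
    refine (continuousAt_extChartAt_symm (I := I) x).eventually (p := fun y => y ∈ U) ?_
    rw [← hφ, hsymm0]; exact hU.mem_nhds hxU
  obtain ⟨r, hr, hball⟩ := Metric.eventually_nhds_iff_ball.1 hnear
  set B := Metric.ball (φ x) r with hB
  -- the differential of the chart, and the one-form read in the chart
  let D : M → E →L[ℝ] E := fun y => mfderiv I 𝓘(ℝ, E) φ y
  let η : E → E →L[ℝ] ℝ := fun z =>
    (θ (φ.symm z) : E →L[ℝ] ℝ).comp (D (φ.symm z)).inverse
  let h : E → M → ℝ := fun u y => θ y (V u y)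
  have hVD : ∀ u, ∀ y ∈ U, @Eq E (V u y) ((D y).inverse u) := fun u y hy => hV' u y hy
  have hηh : ∀ u, ∀ z ∈ B, η z u = h u (φ.symm z) := by
    intro u z hz
    exact congrArg (θ (φ.symm z) : E →L[ℝ] ℝ) (hVD u _ (hball z hz).2).symm
  have hinv : ∀ y ∈ U, (D y).IsInvertible := fun y hy => isInvertible_mfderiv_extChartAt (hUs hy)
  have hsymm : ∀ z ∈ B, HasMFDerivAt 𝓘(ℝ, E) I φ.symm z (D (φ.symm z)).inverse := by
    intro z hz
    have hzn : φ.target ∈ 𝓝 z := by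
      filter_upwards [Metric.isOpen_ball.mem_nhds hz] with w hw using (hball w hw).1
    have hd : MDifferentiableAt 𝓘(ℝ, E) I φ.symm z :=
      ((contMDiffOn_extChartAt_symm (n := 1) x).contMDiffAt hzn).mdifferentiableAt (by simp)
    obtain ⟨L, hL⟩ : ∃ L : E →L[ℝ] E, L = mfderiv 𝓘(ℝ, E) I φ.symm z := ⟨_, rfl⟩
    have hL' : HasMFDerivAt 𝓘(ℝ, E) I φ.symm z L := by rw [hL]; exact hd.hasMFDerivAt
    have h1 : (D (φ.symm z)).comp L = ContinuousLinearMap.id ℝ E := by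
      have h2 := mfderiv_extChartAt_comp_mfderivWithin_extChartAt_symm (I := I) (hball z hz).1
      rw [I.range_eq_univ, mfderivWithin_univ] at h2
      rw [hL]; exact h2
    obtain ⟨e, he⟩ := hinv _ (hball z hz).2
    have h3 : (D (φ.symm z)).inverse = L := by
      rw [← he] at h1 ⊢
      rw [ContinuousLinearMap.inverse_equiv]
      ext w
      have := congrArg (fun A : E →L[ℝ] E => A w) h1
      exact (e.symm_apply_eq).2 this.symm
    rw [h3]; exact hL'
  have hder : ∀ u, ∀ z ∈ B, ∃ A : E →L[ℝ] ℝ, HasFDerivAt (fun z => η z u) A z ∧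
      ∀ w, A w = mvfderiv I (h u) (φ.symm z) (V w (φ.symm z)) := by
    intro u z hz
    have hd : MDifferentiableAt I 𝓘(ℝ, ℝ) (h u) (φ.symm z) :=
      (contMDiff_oneForm_apply hθ (hV u)).mdifferentiable (by simp) _
    obtain ⟨K, hK⟩ : ∃ K : E →L[ℝ] ℝ, K = mfderiv I 𝓘(ℝ, ℝ) (h u) (φ.symm z) := ⟨_, rfl⟩
    have hK' : HasMFDerivAt I 𝓘(ℝ, ℝ) (h u) (φ.symm z) K := by rw [hK]; exact hd.hasMFDerivAt
    have h1 : HasMFDerivAt 𝓘(ℝ, E) 𝓘(ℝ, ℝ) (h u ∘ φ.symm) z (K.comp (D (φ.symm z)).inverse) :=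
      HasMFDerivAt.comp z (g := h u) (f := φ.symm) hK' (hsymm z hz)
    have h2 : HasFDerivAt (h u ∘ φ.symm) (K.comp (D (φ.symm z)).inverse) z :=
      hasMFDerivAt_iff_hasFDerivAt.1 h1
    refine ⟨_, h2.congr_of_eventuallyEq ?_, fun w => ?_⟩
    · filter_upwards [Metric.isOpen_ball.mem_nhds hz] with w hw using hηh u w hw
    · have h3 : K ((D (φ.symm z)).inverse w) = K (V w (φ.symm z)) :=
        congrArg K (hVD w _ (hball z hz).2).symm
      refine h3.trans ?_
      rw [hK]; rfl
  have hdiff : DifferentiableOn ℝ η B := by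
    refine differentiableOn_of_forall_apply fun u z hz => ?_
    obtain ⟨A, hA, -⟩ := hder u z hz
    exact hA.differentiableAt.differentiableWithinAt
  -- the symmetry of the derivative of `η` is closedness on the commuting coordinate fields
  obtain ⟨f, hf⟩ := Convex.exists_forall_hasFDerivAt_of_fderiv_symmetric (convex_ball (φ x) r)
    Metric.isOpen_ball hdiff (by
      intro z hz u v
      have hda : DifferentiableAt ℝ η z := hdiff.differentiableAt (Metric.isOpen_ball.mem_nhds hz)
      have key : ∀ u v : E, fderiv ℝ η z u v
          = mvfderiv I (h v) (φ.symm z) (V u (φ.symm z)) := by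
        intro u v
        obtain ⟨A, hA, hA'⟩ := hder v z hz
        have h1 : HasFDerivAt (fun z => η z v)
            ((ContinuousLinearMap.apply ℝ ℝ v).comp (fderiv ℝ η z)) z :=
          (ContinuousLinearMap.apply ℝ ℝ v).hasFDerivAt.comp z hda.hasFDerivAt
        rw [← hA', hA.unique h1]
        rfl
      rw [key, key]
      have h1 := hc (V u) (V v) (hV u) (hV v) (φ.symm z)
      have h2 := mlieBracket_coordinate_fields I hU hUs (hV' u) (hV' v) (hball z hz).2
      rw [extDerivOne, h2, map_zero, sub_zero] at h1
      exact sub_eq_zero.1 h1)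
  refine ⟨φ.source ∩ φ ⁻¹' B, ?_, ⟨mem_extChartAt_source x, Metric.mem_ball_self hr⟩, ?_, f ∘ φ, ?_⟩
  · exact isOpen_extChartAt_preimage' x Metric.isOpen_ball
  · have h1 : φ.source ∩ φ ⁻¹' B = φ.symm '' B := by
      rw [φ.symm_image_eq_source_inter_preimage]
      exact fun z hz => (hball z hz).1
    rw [h1]
    refine (convex_ball (φ x) r).isPreconnected.image _ ?_
    exact (continuousOn_extChartAt_symm x).mono fun z hz => (hball z hz).1
  · rintro y ⟨hys, hyB⟩
    have hyB' : φ y ∈ B := hyB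
    have hyU : y ∈ U := by
      have := (hball _ hyB').2
      rwa [φ.left_inv hys] at this
    have h1 : HasMFDerivAt I 𝓘(ℝ, E) φ y (D y) :=
      (mdifferentiableAt_extChartAt (by rwa [← extChartAt_source I])).hasMFDerivAt
    have h2 : HasMFDerivAt I 𝓘(ℝ, ℝ) (f ∘ φ) y ((η (φ y)).comp (D y)) :=
      HasMFDerivAt.comp y (g := f) (f := φ) (hf _ hyB').hasMFDerivAt h1
    refine h2.congr_mfderiv ?_
    obtain ⟨e, he⟩ := hinv y hyU
    have h3 : ∀ y', y' = y → ((θ y' : E →L[ℝ] ℝ).comp (D y').inverse).comp (D y) = θ y := by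
      rintro _ rfl
      rw [← he, ContinuousLinearMap.inverse_equiv]
      ext w
      exact congrArg (θ _ : E →L[ℝ] ℝ) (e.symm_apply_apply w)
    exact h3 _ (φ.left_inv hys)

end Primitive

/-! ### Closed one-forms on fundamental fields -/

section ClosedInvariant

variable {E : Type*} [NormedAddCommGroup E] [NormedSpace ℝ E] [FiniteDimensional ℝ E]
  {H : Type*} [TopologicalSpace H] {I : ModelWithCorners ℝ E H} [I.Boundaryless]
  {M : Type*} [TopologicalSpace M] [ChartedSpace H M] [IsManifold I ∞ M] [T2Space M]
  {F : Type*} [NormedAddCommGroup F] [NormedSpace ℝ F] [FiniteDimensional ℝ F]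
  {H' : Type*} [TopologicalSpace H'] (I' : ModelWithCorners ℝ F H') [I'.Boundaryless]
  {G : Type*} [TopologicalSpace G] [ChartedSpace H' G] [Group G] [LieGroup I' ∞ G]
  [MulAction G M] [ContMDiffSMul I' I ∞ G M]

/-- An invariant closed one-form takes a constant value on each fundamental field: by Cartan's
formula the differential of this value is a Lie derivative of the form. -/
theorem oneForm_fundamentalField_eq [PreconnectedSpace M]
    {θ : ∀ x : M, TangentSpace I x →L[ℝ] ℝ} (hθ : IsSmoothOneForm I θ)
    (hc : ∀ X Y : (∀ x : M, TangentSpace I x), IsSmoothField I X → IsSmoothField I Y →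
      ∀ x, extDerivOne I θ X Y x = 0) (hinv : PreservesOneForm I G θ)
    (ξ : GroupLieAlgebra I' G) (x y : M) :
    θ x (fundamentalField I' I ξ x) = θ y (fundamentalField I' I ξ y) := by
  have : CompleteSpace E := FiniteDimensional.complete ℝ E
  have hξ := isSmoothField_fundamentalField I' (M := M) (I := I) ξ
  refine eq_of_hasMFDerivAt_zero (I := I) (f := fun y => θ y (fundamentalField I' I ξ y))
    (fun z => ?_) x y
  have hd : ∀ V : (∀ y : M, TangentSpace I y), IsSmoothField I V →
      MDifferentiableAt I 𝓘(ℝ, ℝ) (fun y => θ y (V y)) z := fun V hV =>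
    (contMDiff_oneForm_apply hθ hV).mdifferentiable (by simp) z
  refine (hd _ hξ).hasMFDerivAt.congr_mfderiv ?_
  ext u
  obtain ⟨V, hV, hVu⟩ := exists_smooth_field I z u
  have h1 := hc _ V hξ hV z
  have h2 := mvfderiv_oneForm_fundamentalField I' hinv hV (hd V hV) ξ
  rw [extDerivOne, h2, hVu] at h1
  have h3 : mvfderiv I (fun y => θ y (fundamentalField I' I ξ y)) z u = 0 := by linarith
  exact h3

/-- A nonzero closed one-form is nonzero on some fundamental field of a transitive action: otherwise
the pullbacks of its local primitives to `G` are locally constant, hence these primitives take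
countably many values and are locally constant themselves. -/
theorem exists_fundamentalField_ne_zero [MulAction.IsPretransitive G M] [CompactSpace G]
    {θ : ∀ x : M, TangentSpace I x →L[ℝ] ℝ} (hθ : IsSmoothOneForm I θ)
    (hc : ∀ X Y : (∀ x : M, TangentSpace I x), IsSmoothField I X → IsSmoothField I Y →
      ∀ x, extDerivOne I θ X Y x = 0) {x : M} (hx : θ x ≠ 0) :
    ∃ (ξ : GroupLieAlgebra I' G) (y : M), θ y (fundamentalField I' I ξ y) ≠ 0 := by
  by_contra! hzero
  apply hx
  have : CompleteSpace E := FiniteDimensional.complete ℝ E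
  have : CompleteSpace F := FiniteDimensional.complete ℝ F
  have : SecondCountableTopology H' := I'.isClosedEmbedding.isEmbedding.secondCountableTopology
  have : SecondCountableTopology G := ChartedSpace.secondCountable_of_sigmaCompact H' G
  obtain ⟨U, hU, hxU, hUc, f, hf⟩ := exists_local_primitive hθ hc x
  let k : G → M := fun a => a • x
  have hk : Continuous k := continuous_iff_continuousAt.2 fun a =>
    (mdifferentiableAt_smul_const (I := I) I' a x).continuousAt
  have hO : IsOpen (k ⁻¹' U) := hU.preimage hk
  have hder : ∀ a ∈ k ⁻¹' U, HasMFDerivAt I' 𝓘(ℝ, ℝ) (f ∘ k) a 0 := by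
    intro a ha
    have h1 : HasMFDerivAt I' I k a (mfderiv I' I k a) :=
      (mdifferentiableAt_smul_const I' a x).hasMFDerivAt
    refine (HasMFDerivAt.comp a (hf _ ha) h1).congr_mfderiv ?_
    ext v
    obtain ⟨e, he⟩ := isInvertible_mfderiv_mul_right I' a
    obtain ⟨ξ, hξ⟩ : ∃ ξ : F, @Eq F (mfderiv I' I' (fun y : G => y * a) 1 ξ) v :=
      ⟨e.symm v, by rw [← he]; exact e.apply_symm_apply v⟩
    have h2 := mfderiv_orbit_mfderiv_mul_right I' (I := I) ξ a x
    have h3 : @Eq E (mfderiv I' I k a v) (fundamentalField I' I (G := G) ξ (a • x)) :=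
      Eq.trans (congrArg (fun w : F => (mfderiv I' I k a : F →L[ℝ] E) w) hξ.symm) h2
    exact (congrArg (θ (a • x) : E →L[ℝ] ℝ) h3).trans (hzero ξ (a • x))
  have hloc : ∀ a ∈ k ⁻¹' U, {b | f (k b) = f (k a)} ∈ 𝓝[k ⁻¹' U] a := by
    intro a ha
    refine mem_nhdsWithin_of_mem_nhds ?_
    refine eventually_eq_of_hasMFDerivAt_zero (I := I') (f := f ∘ k) ?_
    filter_upwards [hO.mem_nhds ha] with b hb using hder b hb
  obtain ⟨t, -, ht, hcov⟩ := TopologicalSpace.countable_cover_nhdsWithin hloc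
  have hcount : (f '' U).Countable := by
    refine (ht.image (f ∘ k)).mono ?_
    rintro _ ⟨y, hy, rfl⟩
    obtain ⟨b, rfl⟩ := MulAction.exists_smul_eq G x y
    obtain ⟨a, ha, hab⟩ := Set.mem_iUnion₂.1 (hcov (show b ∈ k ⁻¹' U from hy))
    exact ⟨a, ha, hab.symm⟩
  have hfc : ContinuousOn f U := fun y hy => (hf y hy).continuousAt.continuousWithinAt
  have hsub : (f '' U).Subsingleton :=
    hcount.isTotallyDisconnected _ subset_rfl (hUc.image f hfc)
  have h1 : HasMFDerivAt I 𝓘(ℝ, ℝ) f x 0 := by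
    refine (hasMFDerivAt_const (f x) x).congr_of_eventuallyEq ?_
    filter_upwards [hU.mem_nhds hxU] with y hy
    exact hsub ⟨y, hy, rfl⟩ ⟨x, hxU, rfl⟩
  exact hasMFDerivAt_unique (hf x hxU) h1

end ClosedInvariant

/-! ### Linear algebra of the wedge product with the fundamental form -/

section LinearAlgebra

variable {E : Type*} [NormedAddCommGroup E] [NormedSpace ℝ E] [FiniteDimensional ℝ E]

/-- The wedge product with the fundamental form is injective on one-forms in dimension at least
three. In the proof `v` spans, with `J v`, a complex line orthogonal to the dual vector `u`
of `β`. -/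
theorem eq_zero_of_wedge_fundamentalForm_eq_zero {B : E →L[ℝ] E →L[ℝ] ℝ} {J : E →L[ℝ] E}
    (hpos : ∀ v, v ≠ 0 → 0 < B v v) (hJ : ∀ v, J (J v) = -v)
    (hskew : ∀ v w, B (J v) w = -B v (J w)) {β : E →L[ℝ] ℝ} {u : E} (hu : ∀ v, B u v = β v)
    (hβ : ∀ p q r, β p * B (J q) r - β q * B (J p) r + β r * B (J p) q = 0)
    (hE : 2 < Module.finrank ℝ E) : β = 0 := by
  let Φ : E →ₗ[ℝ] ℝ × ℝ := (B u : E →ₗ[ℝ] ℝ).prod (B (J u) : E →ₗ[ℝ] ℝ)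
  have hker : LinearMap.ker Φ ≠ ⊥ := LinearMap.ker_ne_bot_of_finrank_lt (by simpa using hE)
  obtain ⟨v, hv, hv0⟩ := (Submodule.ne_bot_iff _).1 hker
  have h1 : B u v = 0 := congrArg Prod.fst hv
  have h2 : B (J u) v = 0 := congrArg Prod.snd hv
  have hJv : J v ≠ 0 := fun h => hv0 (by have := hJ v; rw [h, map_zero] at this; simpa using this)
  have h3 := hβ u v (J v)
  have h4 : B u (J v) = 0 := by have := hskew u v; linarith
  rw [← hu, ← hu, ← hu, h1, h4, zero_mul, zero_mul, sub_zero, add_zero] at h3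
  have h5 : B u u = 0 := (mul_eq_zero.1 h3).resolve_right (hpos _ hJv).ne'
  have h6 : u = 0 := by
    by_contra h
    exact (hpos u h).ne' h5
  ext w
  rw [← hu, h6]; simp

/-- A three-form vanishes in dimension at most two. -/
theorem wedge_eq_zero_of_finrank_le_two {B : E →L[ℝ] E →L[ℝ] ℝ} (hB : ∀ v w, B v w = -B w v)
    (β : E →L[ℝ] ℝ) (hE : Module.finrank ℝ E ≤ 2) (p q r : E) :
    β p * B q r - β q * B p r + β r * B p q = 0 := by
  have hdep : ¬ LinearIndependent ℝ ![p, q, r] := by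
    intro h
    have := h.fintype_card_le_finrank
    simp at this
    omega
  obtain ⟨c, hc, i, hi⟩ := Fintype.not_linearIndependent_iff.1 hdep
  simp only [Fin.sum_univ_three, Matrix.cons_val_zero, Matrix.cons_val_one, Matrix.cons_val] at hc
  have h0 : ∀ w, c 0 * B p w + c 1 * B q w + c 2 * B r w = 0 := fun w => by
    have := congrArg (fun v => B v w) hc
    simpa using this
  have hβ : c 0 * β p + c 1 * β q + c 2 * β r = 0 := by
    have := congrArg β hc
    simpa using this
  have hself : ∀ v, B v v = 0 := fun v => by have := hB v v; linarith
  have hp := h0 p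
  have hq := h0 q
  have hr := h0 r
  rw [hself, hB q p, hB r p] at hp
  rw [hself, hB r q] at hq
  rw [hself] at hr
  refine (mul_eq_zero.1 (?_ : c i * _ = 0)).resolve_left hi
  fin_cases i
  · simp only [Fin.zero_eta]
    linear_combination (B q r) * hβ - β q * hr + β r * hq
  · simp only [Fin.mk_one]
    linear_combination -(B p r) * hβ + β p * hr - β r * hp
  · simp only [Fin.reduceFinMk]
    linear_combination (B p q) * hβ - β p * hq + β q * hp

end LinearAlgebra

/-! ### Invariance of the Lee form -/

section Hermitian

variable {E : Type*} [NormedAddCommGroup E] [NormedSpace ℝ E]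
  {H : Type*} [TopologicalSpace H] {I : ModelWithCorners ℝ E H}
  {M : Type*} [TopologicalSpace M] [ChartedSpace H M] [IsManifold I ∞ M]
  {g : Metric I M} {J : ∀ x : M, TangentSpace I x →L[ℝ] TangentSpace I x}

theorem IsHermitian.fundamentalForm_swap (h : IsHermitian g J) (x : M) (u v : TangentSpace I x) :
    fundamentalForm g J x u v = -fundamentalForm g J x v u :=
  (h.skew x u v).trans (congrArg Neg.neg (g.symm x u (J x v)))

theorem preservesTwoForm_fundamentalForm {G : Type*} [Group G] [MulAction G M]
    (hg : PreservesMetric G g) (hJ : PreservesComplex G J) :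
    PreservesTwoForm I G (fundamentalForm g J) := by
  intro a x u v
  have h1 := hJ a x u
  have h2 := hg a x (J x u) v
  rw [h1] at h2
  exact h2

end Hermitian

section Naturality

variable {E : Type*} [NormedAddCommGroup E] [NormedSpace ℝ E] [CompleteSpace E]
  {H : Type*} [TopologicalSpace H] {I : ModelWithCorners ℝ E H} [I.Boundaryless]
  {M : Type*} [TopologicalSpace M] [ChartedSpace H M] [IsManifold I ∞ M]
  {F : Type*} [NormedAddCommGroup F] [NormedSpace ℝ F]
  {H' : Type*} [TopologicalSpace H'] (I' : ModelWithCorners ℝ F H') [I'.Boundaryless]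
  {G : Type*} [TopologicalSpace G] [ChartedSpace H' G] [Group G] [LieGroup I' ∞ G]
  [MulAction G M] [ContMDiffSMul I' I ∞ G M]

include I' in
theorem IsSmoothField.mpullback_smul {V : ∀ y : M, TangentSpace I y} (hV : IsSmoothField I V)
    (a : G) : IsSmoothField I (VectorField.mpullback I I (fun y : M => a • y) V) := by
  have : IsManifold I 1 M := IsManifold.of_le (n := ∞) (by simp)
  exact ContMDiff.mpullback_vectorField (n := ∞) (m := ∞) hV (contMDiff_const_smul' I' a)
    (fun x => isInvertible_mfderiv_smul I' a x) (by simp)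

include I' in
theorem mvfderiv_comp_smul {h : M → ℝ} {a : G} {x : M}
    (hh : MDifferentiableAt I 𝓘(ℝ, ℝ) h (a • x)) (V : ∀ y : M, TangentSpace I y) :
    mvfderiv I (fun y => h (a • y)) x (VectorField.mpullback I I (fun y : M => a • y) V x)
      = mvfderiv I h (a • x) (V (a • x)) := by
  have h1 := mfderiv_comp_apply (I := I) (I' := I) (I'' := 𝓘(ℝ, ℝ)) x (g := h)
    (f := fun y : M => a • y) hh (mdifferentiableAt_const_smul I' a x)
    (VectorField.mpullback I I (fun y : M => a • y) V x)
  rw [mfderiv_smul_mpullback I' a V x] at h1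
  exact h1

include I' in
theorem mlieBracket_mpullback_smul {V W : ∀ y : M, TangentSpace I y} (hV : IsSmoothField I V)
    (hW : IsSmoothField I W) (a : G) (x : M) :
    VectorField.mlieBracket I (VectorField.mpullback I I (fun y : M => a • y) V)
      (VectorField.mpullback I I (fun y : M => a • y) W) x
      = VectorField.mpullback I I (fun y : M => a • y) (VectorField.mlieBracket I V W) x := by
  have : IsManifold I (minSmoothness ℝ 3) M := by
    rw [minSmoothness_of_isRCLikeNormedField]
    exact IsManifold.of_le (n := ∞) ENat.LEInfty.out
  exact (VectorField.mpullback_mlieBracket (n := ∞) (hV.mdifferentiable (by simp) _)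
    (hW.mdifferentiable (by simp) _) (contMDiff_const_smul' I' a).contMDiffAt
    (by rw [minSmoothness_of_isRCLikeNormedField]; exact ENat.LEInfty.out)).symm

include I' in
/-- The exterior derivative of an invariant two-form is invariant. -/
theorem extDerivTwo_mpullback_smul
    {Ω : ∀ x : M, TangentSpace I x →L[ℝ] TangentSpace I x →L[ℝ] ℝ} (hΩ : PreservesTwoForm I G Ω)
    (hd : ∀ V W : (∀ x : M, TangentSpace I x), IsSmoothField I V → IsSmoothField I W →
      ContMDiff I 𝓘(ℝ, ℝ) ∞ (fun y => Ω y (V y) (W y)))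
    {V W Z : ∀ y : M, TangentSpace I y} (hV : IsSmoothField I V) (hW : IsSmoothField I W)
    (hZ : IsSmoothField I Z) (a : G) (x : M) :
    extDerivTwo I Ω (VectorField.mpullback I I (fun y : M => a • y) V)
      (VectorField.mpullback I I (fun y : M => a • y) W)
      (VectorField.mpullback I I (fun y : M => a • y) Z) x = extDerivTwo I Ω V W Z (a • x) := by
  have h0 : ∀ V W : (∀ y : M, TangentSpace I y), ∀ y,
      Ω y (VectorField.mpullback I I (fun y : M => a • y) V y)
        (VectorField.mpullback I I (fun y : M => a • y) W y)
      = Ω (a • y) (V (a • y)) (W (a • y)) := by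
    intro V W y
    rw [← hΩ a y, mfderiv_smul_mpullback I' a V y, mfderiv_smul_mpullback I' a W y]
  have h1 : ∀ {V W Z : ∀ y : M, TangentSpace I y}, IsSmoothField I W → IsSmoothField I Z →
      mvfderiv I (fun y => Ω y (VectorField.mpullback I I (fun y : M => a • y) W y)
        (VectorField.mpullback I I (fun y : M => a • y) Z y)) x
        (VectorField.mpullback I I (fun y : M => a • y) V x)
      = mvfderiv I (fun y => Ω y (W y) (Z y)) (a • x) (V (a • x)) := by
    intro V W Z hW hZ
    have h2 : (fun y => Ω y (VectorField.mpullback I I (fun y : M => a • y) W y)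
        (VectorField.mpullback I I (fun y : M => a • y) Z y))
        = fun y => Ω (a • y) (W (a • y)) (Z (a • y)) := funext (h0 W Z)
    rw [h2]
    exact mvfderiv_comp_smul I' (h := fun y => Ω y (W y) (Z y))
      ((hd W Z hW hZ).mdifferentiable (by simp) _) V
  unfold extDerivTwo
  rw [h1 hW hZ, h1 hV hZ, h1 hV hW, mlieBracket_mpullback_smul I' hV hW,
    mlieBracket_mpullback_smul I' hV hZ, mlieBracket_mpullback_smul I' hW hZ, h0, h0, h0]

end Naturality

section LeeForm

variable {E : Type*} [NormedAddCommGroup E] [NormedSpace ℝ E] [FiniteDimensional ℝ E]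
  {H : Type*} [TopologicalSpace H] {I : ModelWithCorners ℝ E H} [I.Boundaryless]
  {M : Type*} [TopologicalSpace M] [ChartedSpace H M] [IsManifold I ∞ M] [T2Space M]
  {F : Type*} [NormedAddCommGroup F] [NormedSpace ℝ F]
  {H' : Type*} [TopologicalSpace H'] (I' : ModelWithCorners ℝ F H') [I'.Boundaryless]
  {G : Type*} [TopologicalSpace G] [ChartedSpace H' G] [Group G] [LieGroup I' ∞ G]
  [MulAction G M] [ContMDiffSMul I' I ∞ G M]
  {g : Metric I M} {J : ∀ x : M, TangentSpace I x →L[ℝ] TangentSpace I x}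
  {θ : ∀ x : M, TangentSpace I x →L[ℝ] ℝ}

/-- In dimension at most two every Hermitian metric is Kähler, for want of nonzero three-forms. -/
theorem IsLCK.two_lt_finrank (h : IsLCK g J θ) (hK : ¬ IsKahler g J) :
    2 < Module.finrank ℝ E := by
  by_contra! hE
  refine hK ⟨h.hermitian, fun X Y Z hX hY hZ x => ?_⟩
  have h1 := wedge_eq_zero_of_finrank_le_two (E := E) (B := fundamentalForm g J x)
    (h.hermitian.fundamentalForm_swap x) (θ x) hE (X x) (Y x) (Z x)
  rw [h.lee X Y Z hX hY hZ x, wedgeOneTwo]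
  exact (congrArg (fun t : ℝ => -2 * t) h1).trans (mul_zero _)

theorem IsLCK.exists_ne_zero (h : IsLCK g J θ) (hK : ¬ IsKahler g J) : ∃ x, θ x ≠ 0 := by
  by_contra! hθ
  refine hK ⟨h.hermitian, fun X Y Z hX hY hZ x => ?_⟩
  rw [h.lee X Y Z hX hY hZ x, wedgeOneTwo, hθ x]
  simp

include I' in
/-- The Lee form is invariant, since it is determined by the fundamental form: both `θ` and its
pullback `θ'` satisfy `dω = -2 θ ∧ ω`, so that `(θ' - θ) ∧ ω = 0`. -/
theorem IsLCK.preservesOneForm (h : IsLCK g J θ) (hK : ¬ IsKahler g J)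
    (hg : PreservesMetric G g) (hJ : PreservesComplex G J) : PreservesOneForm I G θ := by
  have : CompleteSpace E := FiniteDimensional.complete ℝ E
  intro a x
  have hΩ := preservesTwoForm_fundamentalForm hg hJ
  -- the difference of the pulled back Lee form and the Lee form itself
  let β : ∀ y : M, TangentSpace I y →L[ℝ] ℝ := fun y =>
    (θ (a • y) : E →L[ℝ] ℝ).comp (mfderiv I I (fun y : M => a • y) y : E →L[ℝ] E)
      - (θ y : E →L[ℝ] ℝ)
  have hβ : ∀ p q r : TangentSpace I x, β x p * fundamentalForm g J x q r
      - β x q * fundamentalForm g J x p r + β x r * fundamentalForm g J x p q = 0 := by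
    have hex : ∀ p : TangentSpace I x, ∃ V : ∀ y : M, TangentSpace I y, IsSmoothField I V ∧
        V (a • x) = mfderiv I I (fun y : M => a • y) x p ∧
        VectorField.mpullback I I (fun y : M => a • y) V x = p := by
      intro p
      obtain ⟨V, hV, hVp⟩ := exists_smooth_field I (a • x) (mfderiv I I (fun y : M => a • y) x p)
      refine ⟨V, hV, hVp, ?_⟩
      rw [VectorField.mpullback_apply, hVp]
      exact (isInvertible_mfderiv_smul I' a x).inverse_apply_eq.2 rfl
    intro p q r
    obtain ⟨P, hP, hPa, hPx⟩ := hex p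
    obtain ⟨Q, hQ, hQa, hQx⟩ := hex q
    obtain ⟨R, hR, hRa, hRx⟩ := hex r
    have h1 := extDerivTwo_mpullback_smul I' hΩ
      (fun V W hV hW => contMDiff_fundamentalForm_apply h.hermitian.smooth hV hW) hP hQ hR a x
    rw [h.lee _ _ _ (hP.mpullback_smul I' a) (hQ.mpullback_smul I' a) (hR.mpullback_smul I' a),
      h.lee _ _ _ hP hQ hR, wedgeOneTwo, wedgeOneTwo, hPa, hQa, hRa, hPx, hQx, hRx,
      hΩ, hΩ, hΩ] at h1
    have h2 : ∀ p : TangentSpace I x,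
        β x p = θ (a • x) (mfderiv I I (fun y : M => a • y) x p) - θ x p := fun p => rfl
    rw [h2, h2, h2]
    linarith
  have h0 : (β x : E →L[ℝ] ℝ) = 0 := by
    obtain ⟨u, hu⟩ := exists_sharp g β x
    exact eq_zero_of_wedge_fundamentalForm_eq_zero (E := E) (B := g.inner x) (J := J x) (g.pos x)
      (h.hermitian.sq_eq_neg x) (h.hermitian.skew x) hu hβ (h.two_lt_finrank hK)
  intro u
  have h3 : (θ (a • x) (mfderiv I I (fun y : M => a • y) x u) : ℝ) - θ x u = 0 :=
    congrArg (fun b : E →L[ℝ] ℝ => b u) h0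
  exact sub_eq_zero.1 h3

end LeeForm

/-! ### Maxima of functions on manifolds -/

section Maximum

variable {E : Type*} [NormedAddCommGroup E] [NormedSpace ℝ E]
  {H : Type*} [TopologicalSpace H] {I : ModelWithCorners ℝ E H} [I.Boundaryless]
  {M : Type*} [TopologicalSpace M] [ChartedSpace H M]

theorem mvfderiv_eq_zero_of_forall_le {f : M → ℝ} {x : M} (hd : MDifferentiableAt I 𝓘(ℝ, ℝ) f x)
    (hmax : ∀ y, f y ≤ f x) (u : TangentSpace I x) : mvfderiv I f x u = 0 := by
  obtain ⟨L, hL⟩ : ∃ L : E →L[ℝ] ℝ, L = mfderiv I 𝓘(ℝ, ℝ) f x := ⟨_, rfl⟩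
  have h1 : HasMFDerivAt I 𝓘(ℝ, ℝ) f x L := by rw [hL]; exact hd.hasMFDerivAt
  have h2 : HasFDerivWithinAt (writtenInExtChartAt I 𝓘(ℝ, ℝ) x f) L (Set.range I)
      (extChartAt I x x) := h1.2
  rw [I.range_eq_univ, hasFDerivWithinAt_univ] at h2
  have h3 : IsLocalMax (writtenInExtChartAt I 𝓘(ℝ, ℝ) x f) (extChartAt I x x) := by
    refine Filter.Eventually.of_forall fun z => ?_
    simp only [writtenInExtChartAt, extChartAt_model_space_eq_id, PartialEquiv.refl_coe,
      Function.comp_apply, id_eq, extChartAt_to_inv]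
    exact hmax _
  have h4 : L = 0 := h3.hasFDerivAt_eq_zero h2
  have h5 : L u = 0 := by rw [h4]; rfl
  rw [hL] at h5
  exact h5

end Maximum

/-! ### Central elements on which the Lee form vanishes -/

section Center

variable {E : Type*} [NormedAddCommGroup E] [NormedSpace ℝ E] [FiniteDimensional ℝ E]
  {H : Type*} [TopologicalSpace H] {I : ModelWithCorners ℝ E H} [I.Boundaryless]
  {M : Type*} [TopologicalSpace M] [ChartedSpace H M] [IsManifold I ∞ M] [T2Space M]
  {F : Type*} [NormedAddCommGroup F] [NormedSpace ℝ F] [FiniteDimensional ℝ F]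
  {H' : Type*} [TopologicalSpace H'] (I' : ModelWithCorners ℝ F H') [I'.Boundaryless]
  {G : Type*} [TopologicalSpace G] [ChartedSpace H' G] [Group G] [LieGroup I' ∞ G]
  [MulAction G M] [ContMDiffSMul I' I ∞ G M]

/-- Fundamental fields commute with invariant fields. -/
theorem mlieBracket_fundamentalField_eq_zero {V : ∀ y : M, TangentSpace I y}
    (hV : IsSmoothField I V) (hinv : PreservesField I G V) (ξ : GroupLieAlgebra I' G) (x : M) :
    VectorField.mlieBracket I (fundamentalField I' I ξ) V x = 0 := by
  have : CompleteSpace E := FiniteDimensional.complete ℝ E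
  obtain ⟨A, hA, hA'⟩ := hasFDerivAt_mpullback_smul I' (G := G) hV x
  obtain ⟨w, hw⟩ : ∃ w : E, w = V x := ⟨_, rfl⟩
  have h1 : (fun p : F => (VectorField.mpullback I I (fun y : M => groupParam I' G p • y) V x : E))
      = fun _ : F => w := by
    funext p
    rw [VectorField.mpullback_apply, hw]
    exact (isInvertible_mfderiv_smul I' (groupParam I' G p) x).inverse_apply_eq.2
      (hinv (groupParam I' G p) x).symm
  have h3 : HasFDerivAt (fun _ : F => w) A 0 := by
    rw [← h1]; exact hA
  have h2 : A = 0 := h3.unique (hasFDerivAt_const w (0 : F))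
  refine Eq.trans (α := E) (hA' ξ).symm ?_
  rw [h2]; rfl

theorem fundamentalField_add (ξ η : GroupLieAlgebra I' G) (x : M) :
    fundamentalField I' I (ξ + η) x = fundamentalField I' I ξ x + fundamentalField I' I η x := by
  obtain ⟨L, hL⟩ : ∃ L : F →L[ℝ] E, L = mfderiv I' I (fun a : G => a • x) 1 := ⟨_, rfl⟩
  have h : ∀ ξ : F, @Eq E (fundamentalField I' I (G := G) ξ x) (L ξ) := fun ξ => by
    rw [hL]; exact fundamentalField_eq (I := I) I' ξ x
  exact Eq.trans (α := E) (h _) (Eq.trans (map_add L ξ η)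
    (congrArg₂ (fun u v : E => u + v) (h ξ).symm (h η).symm))

theorem fundamentalField_smul (c : ℝ) (ξ : GroupLieAlgebra I' G) (x : M) :
    fundamentalField I' I (c • ξ) x = c • fundamentalField I' I ξ x := by
  obtain ⟨L, hL⟩ : ∃ L : F →L[ℝ] E, L = mfderiv I' I (fun a : G => a • x) 1 := ⟨_, rfl⟩
  have h : ∀ ξ : F, @Eq E (fundamentalField I' I (G := G) ξ x) (L ξ) := fun ξ => by
    rw [hL]; exact fundamentalField_eq (I := I) I' ξ x
  exact Eq.trans (α := E) (h _) (Eq.trans (map_smul L c ξ)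
    (congrArg (fun u : E => c • u) (h ξ).symm))

variable {g : Metric I M} {J : ∀ x : M, TangentSpace I x →L[ℝ] TangentSpace I x}
  {θ : ∀ x : M, TangentSpace I x →L[ℝ] ℝ}

/-- For a central element `Z` and an element `T` of the Lie algebra, Cartan's formula reduces
`dω(Z, T, V)` to the derivative of `ω(Z, T)` along `V`. -/
theorem IsLCK.extDerivTwo_fundamentalField [PreconnectedSpace G] (h : IsLCK g J θ)
    (hg : PreservesMetric G g) (hJ : PreservesComplex G J) {Z : GroupLieAlgebra I' G}
    (hZ : Z ∈ LieAlgebra.center ℝ (GroupLieAlgebra I' G)) (T : GroupLieAlgebra I' G)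
    {V : ∀ y : M, TangentSpace I y} (hV : IsSmoothField I V) (x : M) :
    extDerivTwo I (fundamentalForm g J) (fundamentalField I' I Z) (fundamentalField I' I T) V x
      = mvfderiv I (fun y => fundamentalForm g J y (fundamentalField I' I Z y)
          (fundamentalField I' I T y)) x (V x) := by
  have : CompleteSpace E := FiniteDimensional.complete ℝ E
  have : CompleteSpace F := FiniteDimensional.complete ℝ F
  have hΩ := preservesTwoForm_fundamentalForm hg hJ
  have hZs := isSmoothField_fundamentalField I' (M := M) (I := I) Z
  have hTs := isSmoothField_fundamentalField I' (M := M) (I := I) T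
  have h1 := mvfderiv_twoForm_fundamentalField I' hΩ hTs hV (x := x)
    ((contMDiff_fundamentalForm_apply h.hermitian.smooth hTs hV).mdifferentiable (by simp) x) Z
  have h2 := mvfderiv_twoForm_fundamentalField I' hΩ hZs hV (x := x)
    ((contMDiff_fundamentalForm_apply h.hermitian.smooth hZs hV).mdifferentiable (by simp) x) T
  have h3 := mlieBracket_fundamentalField_eq_zero I' hZs (preservesField_fundamentalField I' hZ) T x
  rw [h3, map_zero] at h2
  unfold extDerivTwo
  rw [h1, h2, h.hermitian.fundamentalForm_swap x (VectorField.mlieBracket I _ V x)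
    (fundamentalField I' I T x), h.hermitian.fundamentalForm_swap x
      (VectorField.mlieBracket I (fundamentalField I' I T) V x) (fundamentalField I' I Z x)]
  simp only [zero_apply]
  ring

/-- A central element on which the Lee form vanishes has a fundamental field that is
`ω`-dual to a multiple of the Lee form: at a maximum of `ω(Z, T)` on the compact manifold the
equation `dω = -2 θ ∧ ω`, evaluated on `Z`, `T` and `V`, says so, and everything is invariant. -/
theorem IsLCK.fundamentalForm_center [PreconnectedSpace G] [CompactSpace M] [Nonempty M]
    [MulAction.IsPretransitive G M] (h : IsLCK g J θ)
    (hg : PreservesMetric G g) (hJ : PreservesComplex G J) (hθ : PreservesOneForm I G θ)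
    {Z T : GroupLieAlgebra I' G} (hZ : Z ∈ LieAlgebra.center ℝ (GroupLieAlgebra I' G))
    (hZθ : ∀ x : M, θ x (fundamentalField I' I Z x) = 0)
    (hT : ∀ x : M, θ x (fundamentalField I' I T x) ≠ 0) :
    ∃ k : ℝ, ∀ (x : M) (v : TangentSpace I x),
      fundamentalForm g J x (fundamentalField I' I Z x) v = k * θ x v := by
  have : CompleteSpace E := FiniteDimensional.complete ℝ E
  have : CompleteSpace F := FiniteDimensional.complete ℝ F
  have hΩ := preservesTwoForm_fundamentalForm hg hJ
  have hZs := isSmoothField_fundamentalField I' (M := M) (I := I) Z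
  have hTs := isSmoothField_fundamentalField I' (M := M) (I := I) T
  have hZp := preservesField_fundamentalField I' (M := M) (I := I) hZ
  have hf := contMDiff_fundamentalForm_apply (g := g) h.hermitian.smooth hZs hTs
  -- at a maximum of `ω(Z, T)` its derivative along any field `V` vanishes
  obtain ⟨x₀, -, hx₀⟩ := isCompact_univ.exists_isMaxOn (Set.univ_nonempty (α := M))
    hf.continuous.continuousOn
  have h0 : ∀ v : TangentSpace I x₀, fundamentalForm g J x₀ (fundamentalField I' I Z x₀) v
      = fundamentalForm g J x₀ (fundamentalField I' I Z x₀) (fundamentalField I' I T x₀)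
        / θ x₀ (fundamentalField I' I T x₀) * θ x₀ v := by
    intro v
    obtain ⟨V, hV, rfl⟩ := exists_smooth_field I x₀ v
    have h1 := h.lee _ _ V hZs hTs hV x₀
    rw [h.extDerivTwo_fundamentalField I' hg hJ hZ T hV,
      mvfderiv_eq_zero_of_forall_le (hf.mdifferentiable (by simp) x₀)
        (fun y => hx₀ (Set.mem_univ y)),
      wedgeOneTwo, hZθ] at h1
    have h2 := hT x₀
    field_simp
    linarith
  refine ⟨fundamentalForm g J x₀ (fundamentalField I' I Z x₀) (fundamentalField I' I T x₀)
    / θ x₀ (fundamentalField I' I T x₀), fun x v => ?_⟩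
  obtain ⟨a, rfl⟩ := MulAction.exists_smul_eq G x₀ x
  obtain ⟨u, rfl⟩ : ∃ u, mfderiv I I (fun y : M => a • y) x₀ u = v :=
    ⟨_, mfderiv_smul_mfderiv_inv_smul I' a x₀ v⟩
  rw [← hZp a x₀, hΩ, hθ]
  exact h0 u

end Center
end LCK

theorem mainTheorem2
    {E : Type*} [NormedAddCommGroup E] [NormedSpace ℝ E] [FiniteDimensional ℝ E]
    {H : Type*} [TopologicalSpace H] (I : ModelWithCorners ℝ E H) [I.Boundaryless]
    {M : Type*} [TopologicalSpace M] [ChartedSpace H M] [IsManifold I ∞ M]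
    [T2Space M] [CompactSpace M]
    {F : Type*} [NormedAddCommGroup F] [NormedSpace ℝ F] [FiniteDimensional ℝ F]
    {H' : Type*} [TopologicalSpace H'] (I' : ModelWithCorners ℝ F H') [I'.Boundaryless]
    {G : Type*} [TopologicalSpace G] [ChartedSpace H' G] [Group G] [LieGroup I' ∞ G]
    [T2Space G] [CompactSpace G] [ConnectedSpace G]
    [MulAction G M] [ContMDiffSMul I' I ∞ G M] [FaithfulSMul G M] [MulAction.IsPretransitive G M]
    (g : LCK.Metric I M) (J : ∀ x : M, TangentSpace I x →L[ℝ] TangentSpace I x)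
    (θ : ∀ x : M, TangentSpace I x →L[ℝ] ℝ)
    (hLCK : LCK.IsLCK g J θ) (hK : ¬ LCK.IsKahler g J)
    (hg : LCK.PreservesMetric G g) (hJ : LCK.PreservesComplex G J) :
    Module.finrank ℝ (LieAlgebra.center ℝ (GroupLieAlgebra I' G)) ≤ 2 ∧
      (2 ≤ Module.finrank ℝ (LieAlgebra.center ℝ (GroupLieAlgebra I' G)) →
        ∃ ζ ∈ LieAlgebra.center ℝ (GroupLieAlgebra I' G),
          ∀ x : M, J x (LCK.sharp g θ x) = LCK.fundamentalField I' I ζ x) := by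
  have : CompleteSpace E := FiniteDimensional.complete ℝ E
  have : CompleteSpace F := FiniteDimensional.complete ℝ F
  have : FiniteDimensional ℝ (GroupLieAlgebra I' G) := inferInstanceAs (FiniteDimensional ℝ F)
  obtain ⟨x₀, hx₀⟩ := hLCK.exists_ne_zero hK
  have : Nonempty M := ⟨x₀⟩
  have : PreconnectedSpace M := by
    have hk : Continuous fun a : G => a • x₀ := continuous_iff_continuousAt.2 fun a =>
      (LCK.mdifferentiableAt_smul_const (I := I) I' a x₀).continuousAt
    exact ⟨by simpa [(MulAction.surjective_smul G x₀).range_eq] using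
      isPreconnected_range hk⟩
  have hθ := hLCK.preservesOneForm I' hK hg hJ
  have hconst := LCK.oneForm_fundamentalField_eq I' hLCK.smooth hLCK.closed hθ
  obtain ⟨T, y₀, hT₀⟩ :=
    LCK.exists_fundamentalField_ne_zero I' (G := G) hLCK.smooth hLCK.closed hx₀
  have hT : ∀ x : M, θ x (LCK.fundamentalField I' I T x) ≠ 0 := fun x => by
    rw [hconst T x y₀]; exact hT₀
  have hcenter := fun (Z : GroupLieAlgebra I' G)
    (hZ : Z ∈ LieAlgebra.center ℝ (GroupLieAlgebra I' G))
    (hZθ : θ x₀ (LCK.fundamentalField I' I Z x₀) = 0) =>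
    hLCK.fundamentalForm_center I' hg hJ hθ hZ (fun x => (hconst Z x x₀).trans hZθ) hT
  -- the values of `θ` and of `ω(·, T)` at one point determine a central element
  let Φ : LieAlgebra.center ℝ (GroupLieAlgebra I' G) →ₗ[ℝ] ℝ × ℝ :=
    { toFun := fun Z => (θ x₀ (LCK.fundamentalField I' I Z.1 x₀),
        LCK.fundamentalForm g J x₀ (LCK.fundamentalField I' I Z.1 x₀)
          (LCK.fundamentalField I' I T x₀))
      map_add' := fun Z W => by
        have h : ((Z + W : LieAlgebra.center ℝ (GroupLieAlgebra I' G)) : GroupLieAlgebra I' G)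
          = Z.1 + W.1 := rfl
        rw [h, LCK.fundamentalField_add, map_add, map_add]
        rfl
      map_smul' := fun c Z => by
        have h : ((c • Z : LieAlgebra.center ℝ (GroupLieAlgebra I' G)) : GroupLieAlgebra I' G)
          = c • Z.1 := rfl
        rw [h, LCK.fundamentalField_smul, map_smul, map_smul]
        rfl }
  have hinj : Function.Injective Φ := by
    rw [injective_iff_map_eq_zero]
    rintro ⟨Z, hZ⟩ h
    have h1 : θ x₀ (LCK.fundamentalField I' I Z x₀) = 0 := congrArg Prod.fst h
    have h2 : LCK.fundamentalForm g J x₀ (LCK.fundamentalField I' I Z x₀)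
      (LCK.fundamentalField I' I T x₀) = 0 := congrArg Prod.snd h
    obtain ⟨k, hk⟩ := hcenter Z hZ h1
    rw [hk] at h2
    have hk0 : k = 0 := (mul_eq_zero.1 h2).resolve_right (hT x₀)
    refine Subtype.ext (LCK.eq_zero_of_fundamentalField_eq_zero I' (M := M) (I := I) fun x => ?_)
    by_contra hne
    have hne' : J x (LCK.fundamentalField I' I Z x) ≠ 0 := fun h0 => hne (by
      have h3 := hLCK.hermitian.sq_eq_neg x (LCK.fundamentalField I' I Z x)
      rw [h0, map_zero] at h3
      exact neg_eq_zero.1 h3.symm)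
    have h4 := hk x (J x (LCK.fundamentalField I' I Z x))
    rw [hk0, zero_mul] at h4
    exact (g.pos x _ hne').ne' h4
  have hle : Module.finrank ℝ (LieAlgebra.center ℝ (GroupLieAlgebra I' G)) ≤ 2 := by
    simpa using LinearMap.finrank_le_finrank_of_injective hinj
  refine ⟨hle, fun hge => ?_⟩
  have hsurj : Function.Surjective Φ :=
    (LinearMap.injective_iff_surjective_of_finrank_eq_finrank (by simp; omega)).1 hinj
  -- these values are those of `J θ♯`, as `ω(J θ♯, ·) = -θ`
  obtain ⟨⟨Z, hZ⟩, hΦ⟩ := hsurj (0, -θ x₀ (LCK.fundamentalField I' I T x₀))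
  have h1 : θ x₀ (LCK.fundamentalField I' I Z x₀) = 0 := congrArg Prod.fst hΦ
  have h2 : LCK.fundamentalForm g J x₀ (LCK.fundamentalField I' I Z x₀)
    (LCK.fundamentalField I' I T x₀) = -θ x₀ (LCK.fundamentalField I' I T x₀) :=
    congrArg Prod.snd hΦ
  obtain ⟨k, hk⟩ := hcenter Z hZ h1
  have hk1 : k = -1 := by
    rw [hk] at h2
    exact mul_right_cancel₀ (hT x₀) (by rw [h2]; ring)
  refine ⟨Z, hZ, fun x => ?_⟩
  have h3 : J x (LCK.fundamentalField I' I Z x) + LCK.sharp g θ x = 0 := by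
    by_contra hne
    refine (g.pos x _ hne).ne' ?_
    have h5 : ∀ v : TangentSpace I x, g.inner x (J x (LCK.fundamentalField I' I Z x)) v
      + g.inner x (LCK.sharp g θ x) v = 0 := fun v => by
      rw [LCK.inner_sharp]
      have h6 : g.inner x (J x (LCK.fundamentalField I' I Z x)) v = k * θ x v := hk x v
      rw [h6, hk1]; ring
    rw [map_add (g.inner x), add_apply]
    exact h5 _
  rw [← neg_eq_of_add_eq_zero_right h3, map_neg, hLCK.hermitian.sq_eq_neg, neg_neg]

end
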